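/- Let $q$ be real with $-1<q<1$, $q\neq 0$. Write $(a;q)_n=\prod_{k=0}^{n-1}(1-aq^k)$ for $0\le n\le\infty$, $(a_1,\dots,a_m;q)_n=\prod_j(a_j;q)_n$, and $${}_r\phi_s\!\left(\begin{matrix}a_1,\dots,a_r\\ b_1,\dots,b_s\end{matrix}\Big|\,q,z\right)=\sum_{n=0}^\infty\frac{(a_1,\dots,a_r;q)_n}{(q,b_1,\dots,b_s;q)_n}\,z^n\left((-1)^nq^{n(n-1)/2}\right)^{s+1-r}.$$ Let $t_1,\dots,t_6\in\mathbb C$ satisfy $\max_{1\le i\le 6}|t_i|<1$ and $t_1t_2t_3t_4\ne q$. Then all the series below converge, the integrand is integrable on $[0,\pi]$, and $$\int_0^\pi \prod_{j=5}^6\left[{}_2\phi_1\!\left(\begin{matrix}t_1e^{i\theta},t_2e^{i\theta}\\ t_1t_2\end{matrix}\Big|\,q,t_je^{-i\theta}\right){}_2\phi_1\!\left(\begin{matrix}t_3e^{-i\theta},t_4e^{-i\theta}\\ t_3t_4\end{matrix}\Big|\,q,t_je^{i\theta}\right)\right]\frac{(e^{2i\theta},e^{-2i\theta};q)_\infty}{\prod_{j=1}^4(t_je^{i\theta},t_je^{-i\theta};q)_\infty}\,d\theta$$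 $$=\frac{2\pi\,(t_1t_2t_3t_4;q)_\infty}{(q;q)_\infty\prod_{1\le j<k\le4}(t_jt_k;q)_\infty}\;{}_6\phi_5\!\left(\begin{matrix}\sqrt{t_1t_2t_3t_4/q},\,-\sqrt{t_1t_2t_3t_4/q},\,t_1t_3,\,t_1t_4,\,t_2t_3,\,t_2t_4\\ \sqrt{t_1t_2t_3t_4q},\,-\sqrt{t_1t_2t_3t_4q},\,t_1t_2,\,t_3t_4,\,t_1t_2t_3t_4/q\end{matrix}\Big|\,q,t_5t_6\right),$$ where $\sqrt{\cdot}$ is the principal complex square root (the value does not depend on the choice of roots). -/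

import Mathlib

/-- The finite `q`-shifted factorial `(a; q)_n = ∏_{k=0}^{n-1} (1 - a q^k)`. -/
noncomputable def qPoch (a q : ℂ) (n : ℕ) : ℂ :=
  ∏ k ∈ Finset.range n, (1 - a * q ^ k)

/-- The infinite `q`-shifted factorial `(a; q)_∞ = ∏_{k=0}^∞ (1 - a q^k)`, for `|q| < 1`. -/
noncomputable def qPochInf (a q : ℂ) : ℂ :=
  ∏' k : ℕ, (1 - a * q ^ k)

/-- For `|q| < 1` the product defining `(a; q)_∞` converges. -/
theorem multipliable_qPochInf (a : ℂ) {q : ℂ} (hq : ‖q‖ < 1) :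
    Multipliable fun k : ℕ => 1 - a * q ^ k := by
  have h : Summable fun k : ℕ => ‖-(a * q ^ k)‖ := by
    simp only [norm_neg, norm_mul, norm_pow]
    exact (summable_geometric_of_lt_one (norm_nonneg q) hq).mul_left _
  simpa [sub_eq_add_neg] using multipliable_one_add_of_summable h

/-- `(a_1, …, a_k; q)_n = ∏_j (a_j; q)_n`. -/
noncomputable def qPochs (as : List ℂ) (q : ℂ) (n : ℕ) : ℂ :=
  (as.map fun a => qPoch a q n).prod

/-- `(a_1, …, a_k; q)_∞ = ∏_j (a_j; q)_∞`. -/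
noncomputable def qPochsInf (as : List ℂ) (q : ℂ) : ℂ :=
  (as.map fun a => qPochInf a q).prod

/-- The `n`-th term of the basic hypergeometric series `_rφ_s(as; bs; q, z)`, where `r` and `s`
are the lengths of `as` and `bs`; here `n.choose 2 = n (n - 1) / 2`. -/
noncomputable def basicHypTerm (as bs : List ℂ) (q z : ℂ) (n : ℕ) : ℂ :=
  qPochs as q n / qPochs (q :: bs) q n * z ^ n *
    ((-1) ^ n * q ^ n.choose 2) ^ ((bs.length : ℤ) + 1 - (as.length : ℤ))

/-- The basic hypergeometric series `_rφ_s(as; bs; q, z)`. -/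
noncomputable def basicHyp (as bs : List ℂ) (q z : ℂ) : ℂ :=
  ∑' n : ℕ, basicHypTerm as bs q z n

/-- `e^{iθ}`. -/
noncomputable def expI (θ : ℝ) : ℂ := Complex.exp (Complex.I * θ)

/-- `e^{-iθ}`. -/
noncomputable def expNegI (θ : ℝ) : ℂ := Complex.exp (-(Complex.I * θ))

/-- The Askey–Wilson weight `(e^{2iθ}, e^{-2iθ}; q)_∞ / ∏_{j=1}^4 (t_j e^{iθ}, t_j e^{-iθ}; q)_∞`,
as a function of `θ`. -/
noncomputable def askeyWilsonWeight (t₁ t₂ t₃ t₄ q : ℂ) (θ : ℝ) : ℂ :=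
  qPochsInf [expI θ ^ 2, expNegI θ ^ 2] q /
    (qPochsInf [t₁ * expI θ, t₁ * expNegI θ] q * qPochsInf [t₂ * expI θ, t₂ * expNegI θ] q *
      qPochsInf [t₃ * expI θ, t₃ * expNegI θ] q * qPochsInf [t₄ * expI θ, t₄ * expNegI θ] q)

/-- The Askey–Wilson total mass
`2π (t₁t₂t₃t₄; q)_∞ / ((q; q)_∞ ∏_{1 ≤ j < k ≤ 4} (t_j t_k; q)_∞)`. -/
noncomputable def askeyWilsonMass (t₁ t₂ t₃ t₄ q : ℂ) : ℂ :=
  2 * (Real.pi : ℂ) * qPochInf (t₁ * t₂ * t₃ * t₄) q /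
    (qPochInf q q *
      qPochsInf [t₁ * t₂, t₁ * t₃, t₁ * t₄, t₂ * t₃, t₂ * t₄, t₃ * t₄] q)

/-- The product of two `₂φ₁` functions
`₂φ₁(t₁e^{iθ}, t₂e^{iθ}; t₁t₂; q, t e^{-iθ}) ₂φ₁(t₃e^{-iθ}, t₄e^{-iθ}; t₃t₄; q, t e^{iθ})`. -/
noncomputable def ismailWilsonProduct (t₁ t₂ t₃ t₄ q t : ℂ) (θ : ℝ) : ℂ :=
  basicHyp [t₁ * expI θ, t₂ * expI θ] [t₁ * t₂] q (t * expNegI θ) *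
    basicHyp [t₃ * expNegI θ, t₄ * expNegI θ] [t₃ * t₄] q (t * expI θ)

/-- The principal complex square root. -/
noncomputable def csqrt (z : ℂ) : ℂ := z ^ (1 / 2 : ℂ)

/-- Numerator parameters of the `₆φ₅`. -/
noncomputable def sixPhiFiveNum (t₁ t₂ t₃ t₄ q : ℂ) : List ℂ :=
  [csqrt (t₁ * t₂ * t₃ * t₄ / q), -csqrt (t₁ * t₂ * t₃ * t₄ / q),
    t₁ * t₃, t₁ * t₄, t₂ * t₃, t₂ * t₄]

/-- Denominator parameters of the `₆φ₅`. -/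
noncomputable def sixPhiFiveDen (t₁ t₂ t₃ t₄ q : ℂ) : List ℂ :=
  [csqrt (t₁ * t₂ * t₃ * t₄ * q), -csqrt (t₁ * t₂ * t₃ * t₄ * q),
    t₁ * t₂, t₃ * t₄, t₁ * t₂ * t₃ * t₄ / q]

/-! Write z = e^{iθ}. The coefficient of tⁿ in the product of the two ₂φ₁ series is `iwPoly`, a
Laurent polynomial P_n(z). Up to normalization it is the Askey–Wilson polynomial (the generating
function of Ismail and Wilson). The P_n are orthogonal for the weight, so integrating the product of
the generating functions at t₅ and t₆ leaves ∑ ‖P_n‖² (t₅t₆)ⁿ, which is the ₆φ₅ times the total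
mass.

Three ingredients carry this. (1) Sears' transformation, obtained from q-Pfaff–Saalschütz by
multiplying power series, expands P_n in the basis (t₁z, t₁/z; q)_k (`iwPoly_eq_sum`).

(2) The total mass is the Askey–Wilson integral (`awIntegral_eq_mass`). Comparing a contour integral
over |z| = 1 and |z| = |q| gives the first moment, hence the effect of t₁ → t₁q. The integral
divided by its conjectured value is invariant under this shift, so by continuity it is constant on
the polydisc. It is computed at (q, -q, √q, -√q), where the weight is elementary.

(3) The factor (t₁z, t₁/z; q)_k (t₂z, t₂/z; q)_j only shifts t₁, t₂ in the weight, so its integral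
is a ratio of masses. Expanding P_n in the t₁-basis and P_m in the t₂-basis, Saalschütz gives
orthogonality and the norms (`sum_sum_awCoeff_mul_awMoment`, `iwInner_eq`). Dominated convergence
justifies integrating termwise. -/

/-! ### Finite q-shifted factorials. -/

theorem qPoch_zero (a q : ℂ) : qPoch a q 0 = 1 := by simp [qPoch]

theorem qPoch_succ (a q : ℂ) (n : ℕ) :
    qPoch a q (n + 1) = qPoch a q n * (1 - a * q ^ n) := by
  simp [qPoch, Finset.prod_range_succ]

theorem qPoch_add (a q : ℂ) (m n : ℕ) :
    qPoch a q (m + n) = qPoch a q m * qPoch (a * q ^ m) q n := by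
  simp only [qPoch, Finset.prod_range_add]
  congr 1
  refine Finset.prod_congr rfl fun k _ => ?_
  rw [pow_add]; ring

theorem qPoch_zero_left (q : ℂ) (n : ℕ) : qPoch 0 q n = 1 := by simp [qPoch]

theorem qPoch_one_succ (q : ℂ) (n : ℕ) : qPoch 1 q (n + 1) = 0 := by
  simp [qPoch, Finset.prod_range_succ']

theorem one_sub_mul_pow_ne_zero {a q : ℂ} (ha : ‖a‖ < 1) (hq : ‖q‖ < 1) (k : ℕ) :
    1 - a * q ^ k ≠ 0 := by
  intro h
  have h1 : ‖a * q ^ k‖ < 1 := by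
    rw [norm_mul, norm_pow]
    calc ‖a‖ * ‖q‖ ^ k ≤ ‖a‖ * 1 := by
          gcongr; exact pow_le_one₀ (norm_nonneg _) hq.le
      _ < 1 := by simpa using ha
  rw [← sub_eq_zero.mp h] at h1
  simp at h1

theorem qPoch_ne_zero {a q : ℂ} (ha : ‖a‖ < 1) (hq : ‖q‖ < 1) (n : ℕ) : qPoch a q n ≠ 0 :=
  Finset.prod_ne_zero_iff.mpr fun k _ => one_sub_mul_pow_ne_zero ha hq k

/-! ### The sums of q-Pfaff–Saalschütz and Sears. -/

/-- The coefficients `(a, b; q)_n / (q, c; q)_n` of a `₂φ₁`. -/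
noncomputable def twoPhiOneCoeff (a b c q : ℂ) (n : ℕ) : ℂ :=
  qPoch a q n * qPoch b q n / (qPoch q q n * qPoch c q n)

theorem twoPhiOneCoeff_zero (a b c q : ℂ) : twoPhiOneCoeff a b c q 0 = 1 := by
  simp [twoPhiOneCoeff, qPoch_zero]

theorem twoPhiOneCoeff_succ {a b c q : ℂ} (n : ℕ) (hq : 1 - q ^ (n + 1) ≠ 0)
    (hc : 1 - c * q ^ n ≠ 0) :
    (1 - q ^ (n + 1)) * (1 - c * q ^ n) * twoPhiOneCoeff a b c q (n + 1) =
      (1 - a * q ^ n) * (1 - b * q ^ n) * twoPhiOneCoeff a b c q n := by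
  have hq' : 1 - q * q ^ n ≠ 0 := by rwa [← pow_succ']
  simp only [twoPhiOneCoeff, qPoch_succ, pow_succ']
  by_cases h : qPoch q q n = 0
  · simp [h]
  by_cases h' : qPoch c q n = 0
  · simp [h']
  have hc' : 1 - q ^ n * c ≠ 0 := by rwa [mul_comm]
  field_simp

open Finset in
/-- The `q`-Pfaff–Saalschütz sum, as a convolution. -/
theorem qPfaffSaalschutz {q : ℂ} (hq : ‖q‖ < 1) (hq0 : q ≠ 0) (α β x : ℂ)
    {n : ℕ} (hc : ∀ k < n, 1 - α * β * x * q ^ k ≠ 0) :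
    ∑ p ∈ antidiagonal n, twoPhiOneCoeff α β (α * β * x) q p.1 * x ^ p.1 *
        (qPoch x q p.2 / qPoch q q p.2) =
      twoPhiOneCoeff (α * x) (β * x) (α * β * x) q n := by
  set c := α * β * x with hcdef
  have hqk : ∀ k : ℕ, 1 - q ^ (k + 1) ≠ 0 := fun k => by
    rw [pow_succ']; exact one_sub_mul_pow_ne_zero hq hq k
  set U : ℕ → ℂ := fun j => twoPhiOneCoeff α β c q j * x ^ j with hU
  set W : ℕ → ℂ := fun m => qPoch x q m / qPoch q q m with hW
  have hUs : ∀ j < n, (1 - q ^ (j + 1)) * (1 - c * q ^ j) * U (j + 1) =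
      x * (1 - α * q ^ j) * (1 - β * q ^ j) * U j := fun j hj => by
    have := twoPhiOneCoeff_succ (a := α) (b := β) j (hqk j) (hc j hj)
    simp only [hU, pow_succ] at this ⊢
    linear_combination x ^ j * x * this
  have hWs : ∀ m, (1 - q ^ (m + 1)) * W (m + 1) = (1 - x * q ^ m) * W m := fun m => by
    have h1 := hqk m
    have h2 := qPoch_ne_zero hq hq m
    simp only [hW, qPoch_succ]
    rw [pow_succ'] at h1 ⊢
    field_simp
  change ∑ p ∈ antidiagonal n, U p.1 * W p.2 = _
  induction n with
  | zero => simp [hU, hW, twoPhiOneCoeff_zero, qPoch_zero]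
  | succ n ih =>
    specialize ih (fun k hk => hc k (by omega)) (fun k hk => hUs k (by omega))
    have key := twoPhiOneCoeff_succ (a := α * x) (b := β * x) n (hqk n) (hc n n.lt_succ_self)
    rw [← ih] at key
    refine mul_left_cancel₀ (mul_ne_zero (hqk n) (hc n n.lt_succ_self)) ?_
    rw [key]
    -- Both sides should satisfy the same first-order recurrence in n. The multiplier is split so
    -- that one part lowers the index of U and the other that of W. After shifting, the two sums
    -- recombine termwise because c = αβx.
    have split : (1 - q ^ (n + 1)) * (1 - c * q ^ n) *
        ∑ p ∈ antidiagonal (n + 1), U p.1 * W p.2 =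
        ∑ p ∈ antidiagonal (n + 1),
          q ^ p.2 * ((1 - q ^ p.1) * (1 - c * q ^ p.1 * q⁻¹) * U p.1) * W p.2 +
        ∑ p ∈ antidiagonal (n + 1),
          (1 - c * q ^ (n + p.1)) * U p.1 * ((1 - q ^ p.2) * W p.2) := by
      rw [mul_sum, ← sum_add_distrib]
      refine sum_congr rfl fun p hp => ?_
      obtain ⟨j, m⟩ := p
      have hjm : j + m = n + 1 := by simpa using hp
      have e1 : q ^ (n + 1) = q ^ j * q ^ m := by rw [← hjm, pow_add]
      have e2 : q ^ n = q ^ j * q ^ m * q⁻¹ := by rw [← e1, pow_succ]; field_simp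
      simp only [pow_add q n j, e1, e2]
      ring
    rw [split, Nat.sum_antidiagonal_succ, Nat.sum_antidiagonal_succ', mul_sum]
    simp only [pow_zero, sub_self, zero_mul, mul_zero, zero_add]
    rw [← sum_add_distrib]
    refine sum_congr rfl fun p hp => ?_
    obtain ⟨j, m⟩ := p
    have hjm : j + m = n := by simpa using hp
    have e0 : 1 - c * q ^ (j + 1) * q⁻¹ = 1 - c * q ^ j := by rw [pow_succ]; field_simp
    simp only [e0, hUs j (by omega), hWs, ← hjm]
    rw [hcdef]
    ring

open PowerSeries in
theorem coeff_qPfaffSaalschutz {q : ℂ} (hq : ‖q‖ < 1) (hq0 : q ≠ 0) (α β x : ℂ) {n : ℕ}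
    (hc : ∀ k < n, 1 - α * β * x * q ^ k ≠ 0) :
    twoPhiOneCoeff (α * x) (β * x) (α * β * x) q n =
      coeff n ((mk fun n => twoPhiOneCoeff α β (α * β * x) q n * x ^ n) *
        mk fun n => qPoch x q n / qPoch q q n) := by
  simp only [coeff_mk, coeff_mul]
  exact (qPfaffSaalschutz hq hq0 α β x hc).symm

-- By the q-binomial theorem the two series are (xT; q)_∞/(T; q)_∞ and its reciprocal. Formally,
-- this is Saalschütz with α = 0, β = 1/x, where the right side contains (1; q)_n and so vanishes
-- for n > 0.
open PowerSeries in
theorem mk_qPoch_mul_mk_qPoch_inv {q : ℂ} (hq : ‖q‖ < 1) (hq0 : q ≠ 0) {x : ℂ} (hx : x ≠ 0) :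
    (mk fun n => qPoch x q n / qPoch q q n) *
      (mk fun n => qPoch x⁻¹ q n / qPoch q q n * x ^ n) = 1 := by
  ext n
  have h := coeff_qPfaffSaalschutz hq hq0 0 x⁻¹ x (n := n) (by simp)
  simp only [zero_mul, inv_mul_cancel₀ hx] at h
  have h1 : twoPhiOneCoeff 0 1 0 q n = coeff n (1 : PowerSeries ℂ) := by
    rcases n with _ | n
    · simp [twoPhiOneCoeff_zero]
    · simp [twoPhiOneCoeff, qPoch_one_succ, coeff_one]
  rw [← h1, h, mul_comm]
  congr 3
  ext n
  simp [twoPhiOneCoeff, qPoch_zero_left]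

open Finset PowerSeries in
/-- Sears' transformation of terminating balanced `₄φ₃` series, as an identity of convolutions. -/
theorem searsTransformation {q : ℂ} (hq : ‖q‖ < 1) (hq0 : q ≠ 0) (α β γ δ : ℂ) {x : ℂ}
    (hx : x ≠ 0) {n : ℕ} (hc : ∀ k < n, 1 - α * β * x * q ^ k ≠ 0)
    (hf : ∀ k < n, 1 - γ * δ * x⁻¹ * q ^ k ≠ 0) :
    ∑ p ∈ antidiagonal n, twoPhiOneCoeff (α * x) (β * x) (α * β * x) q p.1 *
        (twoPhiOneCoeff (γ * x⁻¹) (δ * x⁻¹) (γ * δ * x⁻¹) q p.2 * x ^ p.2) =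
      ∑ p ∈ antidiagonal n, twoPhiOneCoeff α β (α * β * x) q p.1 * x ^ p.1 *
        twoPhiOneCoeff γ δ (γ * δ * x⁻¹) q p.2 := by
  have e1 : (rescale x) (mk fun n => qPoch x⁻¹ q n / qPoch q q n) =
      mk fun n => qPoch x⁻¹ q n / qPoch q q n * x ^ n := by
    ext n; simp [coeff_rescale, mul_comm]
  have e2 : (rescale x) (mk fun n => twoPhiOneCoeff γ δ (γ * δ * x⁻¹) q n * x⁻¹ ^ n) =
      mk fun n => twoPhiOneCoeff γ δ (γ * δ * x⁻¹) q n := by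
    ext n
    simp only [coeff_rescale, coeff_mk, inv_pow]
    field_simp
  -- Saalschütz with 1/x in place of x, then the series variable scaled by x. The q-binomial factor
  -- so produced is inverse to the one coming from α, β, and the two cancel in the product.
  have h2 : ∀ m ≤ n, twoPhiOneCoeff (γ * x⁻¹) (δ * x⁻¹) (γ * δ * x⁻¹) q m * x ^ m =
      coeff m ((mk fun n => twoPhiOneCoeff γ δ (γ * δ * x⁻¹) q n) *
        mk fun n => qPoch x⁻¹ q n / qPoch q q n * x ^ n) := fun m hm => by
    rw [coeff_qPfaffSaalschutz hq hq0 γ δ x⁻¹ fun k hk => hf k (by omega), ← e1, ← e2,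
      ← map_mul, coeff_rescale, mul_comm]
  have h3 := mk_qPoch_mul_mk_qPoch_inv hq hq0 hx
  calc _ = coeff n (((mk fun n => twoPhiOneCoeff α β (α * β * x) q n * x ^ n) *
        mk fun n => qPoch x q n / qPoch q q n) *
      ((mk fun n => twoPhiOneCoeff γ δ (γ * δ * x⁻¹) q n) *
        mk fun n => qPoch x⁻¹ q n / qPoch q q n * x ^ n)) := by
        rw [coeff_mul]
        refine sum_congr rfl fun p hp => ?_
        have hp' : p.1 + p.2 = n := by simpa using hp
        rw [h2 _ (by omega), coeff_qPfaffSaalschutz hq hq0 α β x fun k hk => hc k (by omega)]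
    _ = coeff n ((mk fun n => twoPhiOneCoeff α β (α * β * x) q n * x ^ n) *
        mk fun n => twoPhiOneCoeff γ δ (γ * δ * x⁻¹) q n) := by
        rw [mul_mul_mul_comm, h3, mul_one]
    _ = _ := by simp only [coeff_mul, coeff_mk]

/-! ### Coefficients of the generating function as Askey–Wilson polynomials. -/

/-- Reversal of a `q`-shifted factorial. -/
theorem qPoch_reverse {q y : ℂ} (k : ℕ) : ∀ (m : ℕ) {u : ℂ}, q ≠ 0 → u * y * q ^ (m + k) = q →
    qPoch y q (m + k) =
      qPoch y q k * ((-y) ^ m * q ^ (k * m + m.choose 2)) * qPoch u q m := by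
  intro m
  induction m with
  | zero => intro u _ _; simp [qPoch_zero]
  | succ m ih =>
    intro u hq0 hu
    -- The hypothesis says u = q^{1-m-k}/y. The last factor of (y; q) is thus paired with the first
    -- factor of (u; q), leaving the same relation with uq.
    have hu' : u * y * q ^ (m + k) = 1 := by
      refine mul_right_cancel₀ hq0 ?_
      rw [one_mul, mul_assoc, ← pow_succ]
      rwa [show m + 1 + k = m + k + 1 by ring] at hu
    have h1 := ih (u := u * q) hq0 (by linear_combination q * hu')
    have h2 : qPoch u q (m + 1) = (1 - u) * qPoch (u * q) q m := by
      rw [add_comm, qPoch_add]; simp [qPoch]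
    have h3 : k * (m + 1) + (m + 1).choose 2 = k * m + m.choose 2 + (m + k) := by
      rw [Nat.choose_succ_succ' m 1]; simp; ring
    rw [show m + 1 + k = m + k + 1 by ring, qPoch_succ, h2, h1, h3, pow_add q _ (m + k), pow_succ]
    linear_combination -(qPoch y q k * ((-y) ^ m * q ^ (k * m + m.choose 2)) *
      qPoch (u * q) q m) * hu'

open Finset in
/-- The coefficient of `t ^ n` in the product of the two `₂φ₁` series, at `z = e^{iθ}`. -/
noncomputable def iwPoly (t₁ t₂ t₃ t₄ q z : ℂ) (n : ℕ) : ℂ :=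
  ∑ p ∈ antidiagonal n,
    twoPhiOneCoeff (t₁ * z) (t₂ * z) (t₁ * t₂) q p.1 * z⁻¹ ^ p.1 *
      (twoPhiOneCoeff (t₃ * z⁻¹) (t₄ * z⁻¹) (t₃ * t₄) q p.2 * z ^ p.2)

/-- The coefficients of the Askey–Wilson polynomials in the basis `(t₁ z, t₁ / z; q)_k`. -/
noncomputable def awCoeff (t₁ t₂ t₃ t₄ q : ℂ) (n k : ℕ) : ℂ :=
  (t₁ ^ n * q ^ n.choose 2)⁻¹ * (qPoch (t₁ * t₃) q n * qPoch (t₁ * t₄) q n) /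
      qPoch (t₃ * t₄) q n *
    ((-1) ^ k * q ^ (n - k).choose 2 * qPoch (t₁ * t₂ * t₃ * t₄ * q ^ n * q⁻¹) q k /
      (qPoch q q (n - k) * (qPoch q q k * qPoch (t₁ * t₂) q k * qPoch (t₁ * t₃) q k *
        qPoch (t₁ * t₄) q k)))

theorem qPoch_ne_zero_iff {a q : ℂ} {n : ℕ} :
    qPoch a q n ≠ 0 ↔ ∀ k < n, 1 - a * q ^ k ≠ 0 := by
  simp [qPoch, Finset.prod_ne_zero_iff]

theorem pow_choose_two_add (q : ℂ) (k m : ℕ) :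
    q ^ (k + m).choose 2 = q ^ k.choose 2 * q ^ m.choose 2 * q ^ (k * m) := by
  have h : (k + m).choose 2 = k.choose 2 + m.choose 2 + k * m := by
    induction m with
    | zero => simp
    | succ m ih =>
      rw [← add_assoc, Nat.choose_succ_succ' (k + m) 1, Nat.choose_succ_succ' m 1, ih]
      simp; ring
  rw [h, pow_add, pow_add]

theorem pow_mul_self_eq (q : ℂ) (k : ℕ) : q ^ (k * k) = (q ^ k.choose 2) ^ 2 * q ^ k := by
  rw [← pow_mul, ← pow_add]
  congr 1
  induction k with
  | zero => simp
  | succ k ih =>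
    rw [Nat.choose_succ_succ' k 1]
    simp
    nlinarith

theorem norm_mul_lt_one {a b : ℂ} (ha : ‖a‖ < 1) (hb : ‖b‖ < 1) : ‖a * b‖ < 1 := by
  rw [norm_mul]
  exact mul_lt_one_of_nonneg_of_lt_one_left (norm_nonneg _) ha hb.le

open Finset in
theorem iwPoly_eq_sum {q : ℂ} (hq : ‖q‖ < 1) (hq0 : q ≠ 0) {t₁ t₂ t₃ t₄ z : ℂ}
    (h₁ : ‖t₁‖ < 1) (h₂ : ‖t₂‖ < 1) (h₃ : ‖t₃‖ < 1) (h₄ : ‖t₄‖ < 1)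
    (n₁ : t₁ ≠ 0) (n₃ : t₃ ≠ 0) (n₄ : t₄ ≠ 0) (hz : ‖z‖ = 1) (n : ℕ) :
    iwPoly t₁ t₂ t₃ t₄ q z n =
      ∑ p ∈ antidiagonal n, awCoeff t₁ t₂ t₃ t₄ q n p.1 *
        (qPoch (t₁ * z) q p.1 * qPoch (t₁ * z⁻¹) q p.1) := by
  have hz0 : z ≠ 0 := by rintro rfl; simp at hz
  have h1z : ‖t₁ * z‖ < 1 := by rw [norm_mul, hz, mul_one]; exact h₁
  have h12 := norm_mul_lt_one h₁ h₂
  have h13 := norm_mul_lt_one h₁ h₃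
  have h14 := norm_mul_lt_one h₁ h₄
  have h34 := norm_mul_lt_one h₃ h₄
  have hqn : q ^ n ≠ 0 := pow_ne_zero _ hq0
  -- Sears is applied with α = q^{1-n}/(t₃t₄), β = t₂z, γ = t₃/z, δ = t₄/z and this x, which makes
  -- αβx = t₁t₂ and αx = t₁/z. Writing q^n * q⁻¹ for q^{n-1} covers n = 0.
  set x := t₁ * t₃ * t₄ * q ^ n * q⁻¹ * z⁻¹ with hx
  have hx0 : x ≠ 0 := by positivity
  set α := q * (t₃ * t₄ * q ^ n)⁻¹ with hα
  have e1 : α * (t₂ * z) * x = t₁ * t₂ := by rw [hα, hx]; field_simp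
  have e2 : α * x = t₁ * z⁻¹ := by rw [hα, hx]; field_simp
  have e3 : t₂ * z * x = t₁ * t₂ * t₃ * t₄ * q ^ n * q⁻¹ := by rw [hx]; field_simp
  set f := t₃ * z⁻¹ * (t₄ * z⁻¹) * x⁻¹ with hf
  have hf1 : f * (t₁ * z) * q ^ n = q := by rw [hf, hx]; field_simp
  set g := t₃ * z⁻¹ * x⁻¹ with hg
  have hg1 : g * (t₁ * t₄) * q ^ n = q := by rw [hg, hx]; field_simp
  set h := t₄ * z⁻¹ * x⁻¹ with hh
  have hh1 : h * (t₁ * t₃) * q ^ n = q := by rw [hh, hx]; field_simp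
  have hα1 : α * (t₃ * t₄) * q ^ n = q := by rw [hα]; field_simp
  -- Here f = q^{1-n}/(t₁z) need not lie in the unit disc. Its factorial is nonzero because it is a
  -- reversal of (t₁z; q)_n.
  have hfn : qPoch f q n ≠ 0 := by
    have h := qPoch_reverse 0 n (u := f) (y := t₁ * z) hq0 (by simpa using hf1)
    intro h0
    rw [h0, mul_zero] at h
    exact qPoch_ne_zero h1z hq _ h
  have hfk := qPoch_ne_zero_iff.mp hfn
  have key := searsTransformation hq hq0 α (t₂ * z) (t₃ * z⁻¹) (t₄ * z⁻¹) hx0 (n := n)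
    (by rw [e1]; exact fun k _ => one_sub_mul_pow_ne_zero h12 hq k) hfk
  rw [e1, e2, e3] at key
  -- The common factor, independent of the summation index, that the reversals produce on both sides
  -- of Sears' identity.
  set K := qPoch (t₁ * z) q n * (-1) ^ n * (t₁ ^ n * q ^ n.choose 2)⁻¹ / qPoch (t₃ * t₄) q n
    with hK
  have hxpow : ∀ k m, k + m = n → x ^ k =
      (t₁ * t₃ * t₄) ^ k * ((q ^ k.choose 2) ^ 2 * q ^ (k * m)) * z⁻¹ ^ k := fun k m hkm => by
    have : (q ^ n) ^ k * q⁻¹ ^ k = (q ^ k.choose 2) ^ 2 * q ^ (k * m) := by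
      rw [← pow_mul, ← hkm, add_mul, pow_add, pow_mul_self_eq, mul_comm m k, inv_pow]
      field_simp
    rw [hx, ← this]; ring
  have hU : ∀ p ∈ antidiagonal n,
      twoPhiOneCoeff (t₁ * z) (t₂ * z) (t₁ * t₂) q p.1 * z⁻¹ ^ p.1 *
      (twoPhiOneCoeff (t₃ * z⁻¹) (t₄ * z⁻¹) (t₃ * t₄) q p.2 * z ^ p.2) =
      K * (twoPhiOneCoeff α (t₂ * z) (t₁ * t₂) q p.1 * x ^ p.1 *
        twoPhiOneCoeff (t₃ * z⁻¹) (t₄ * z⁻¹) f q p.2) := by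
    rintro ⟨k, m⟩ hp
    have hkm : k + m = n := by simpa using hp
    have r1 := qPoch_reverse m k hq0 (hkm ▸ hα1)
    have r2 := qPoch_reverse k m hq0 (u := f) (y := t₁ * z) (by rw [add_comm, hkm]; exact hf1)
    rw [hkm] at r1
    rw [add_comm, hkm] at r2
    have a1 : qPoch α q k ≠ 0 := fun h0 => qPoch_ne_zero h34 hq n (by rw [r1, h0, mul_zero])
    have a2 : qPoch f q m ≠ 0 := fun h0 => qPoch_ne_zero h1z hq n (by rw [r2, h0, mul_zero])
    have a3 := qPoch_ne_zero h34 hq m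
    have a4 := qPoch_ne_zero h12 hq k
    have a5 := qPoch_ne_zero hq hq m
    have a6 := qPoch_ne_zero hq hq k
    simp only [twoPhiOneCoeff]
    rw [hK, r1, r2, hxpow k m hkm, ← hkm, pow_choose_two_add, mul_comm m k]
    simp only [neg_pow (t₁ * z), neg_pow (t₃ * t₄), mul_pow, inv_pow, pow_add]
    have s2 : ((-1 : ℂ) ^ m) * (-1) ^ m = 1 := by rw [← mul_pow]; simp
    generalize qPoch (t₂ * z) q k = y₂, qPoch (t₃ * z⁻¹) q m = y₃, qPoch (t₄ * z⁻¹) q m = y₄,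
      qPoch (t₁ * z) q k = y₁
    field_simp
    linear_combination -(y₁ * y₂ * y₃ * y₄) * s2
  have hV : ∀ p ∈ antidiagonal n,
      awCoeff t₁ t₂ t₃ t₄ q n p.1 * (qPoch (t₁ * z) q p.1 * qPoch (t₁ * z⁻¹) q p.1) =
      K * (twoPhiOneCoeff (t₁ * z⁻¹) (t₁ * t₂ * t₃ * t₄ * q ^ n * q⁻¹) (t₁ * t₂) q p.1 *
        (twoPhiOneCoeff g h f q p.2 * x ^ p.2)) := by
    rintro ⟨k, m⟩ hp
    have hkm : k + m = n := by simpa using hp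
    have hkm' : m + k = n := by omega
    have r2 := qPoch_reverse k m hq0 (u := f) (y := t₁ * z) (hkm' ▸ hf1)
    have r3 := qPoch_reverse k m hq0 (u := g) (y := t₁ * t₄) (hkm' ▸ hg1)
    have r4 := qPoch_reverse k m hq0 (u := h) (y := t₁ * t₃) (hkm' ▸ hh1)
    rw [hkm'] at r2 r3 r4
    have a2 : qPoch f q m ≠ 0 := fun h0 => qPoch_ne_zero h1z hq n (by rw [r2, h0, mul_zero])
    have a3 := qPoch_ne_zero h34 hq n
    have a4 := qPoch_ne_zero h12 hq k
    have a5 := qPoch_ne_zero hq hq m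
    have a6 := qPoch_ne_zero hq hq k
    have a7 := qPoch_ne_zero h13 hq k
    have a8 := qPoch_ne_zero h14 hq k
    have hnk : n - k = m := by omega
    simp only [twoPhiOneCoeff, awCoeff, hnk]
    rw [hK, r2, r3, r4, hxpow m k hkm', mul_comm m k]
    simp only [neg_pow (t₁ * z), neg_pow (t₁ * t₄), neg_pow (t₁ * t₃), mul_pow, inv_pow, ← hkm,
      pow_add]
    field_simp
  rw [iwPoly, sum_congr rfl hU, sum_congr rfl hV, ← mul_sum, ← mul_sum, key]

/-! ### Orthogonality as an algebraic identity between coefficients and moments. -/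

/-- The ratio of the integral of `(t₁ z, t₁ / z; q)_k (t₂ z, t₂ / z; q)_j` against the
Askey–Wilson weight to the total mass. -/
noncomputable def awMoment (t₁ t₂ t₃ t₄ q : ℂ) (k j : ℕ) : ℂ :=
  qPoch (t₁ * t₂) q (k + j) * (qPoch (t₁ * t₃) q k * qPoch (t₁ * t₄) q k) *
    (qPoch (t₂ * t₃) q j * qPoch (t₂ * t₄) q j) / qPoch (t₁ * t₂ * t₃ * t₄) q (k + j)

/-- The squared norms of the polynomials `iwPoly`, relative to the total mass. -/
noncomputable def awNorm (t₁ t₂ t₃ t₄ q : ℂ) (n : ℕ) : ℂ :=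
  qPoch (t₁ * t₃) q n * qPoch (t₁ * t₄) q n * qPoch (t₂ * t₃) q n * qPoch (t₂ * t₄) q n *
      qPoch (t₁ * t₂ * t₃ * t₄ * q ^ n * q⁻¹) q n /
    (qPoch (t₁ * t₂ * t₃ * t₄) q (2 * n) * qPoch (t₃ * t₄) q n * qPoch q q n *
      qPoch (t₁ * t₂) q n)

-- After reversal this is Saalschütz with α = Aq^{n-1}, β = cq^j and x = q^{1-n-j}/A, so that αβx =
-- c. The right side then contains (αx; q)_n with αx = q^{-j}, the source of orthogonality.
open Finset in
theorem sum_awCoeff_mul_awMoment_aux {q : ℂ} (hq : ‖q‖ < 1) (hq0 : q ≠ 0) {A c : ℂ}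
    (hA : ‖A‖ < 1) (hA0 : A ≠ 0) (hc : ‖c‖ < 1) (n j : ℕ) {x : ℂ}
    (hx : x * (A * q ^ j) * q ^ n = q) :
    ∑ p ∈ antidiagonal n, (-1) ^ p.1 * q ^ p.2.choose 2 * qPoch (A * q ^ n * q⁻¹) q p.1 *
        qPoch c q (p.1 + j) / (qPoch q q p.2 * qPoch q q p.1 * qPoch c q p.1 *
          qPoch A q (p.1 + j)) =
      qPoch c q j / qPoch A q (n + j) * ((-1) ^ n * (A * q ^ j) ^ n * (q ^ n.choose 2) ^ 2) *
        twoPhiOneCoeff (A * q ^ n * q⁻¹ * x) (c * q ^ j * x) c q n := by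
  have hAj : ‖A * q ^ j‖ < 1 := by
    rw [norm_mul, norm_pow]
    exact mul_lt_one_of_nonneg_of_lt_one_left (norm_nonneg _) hA
      (pow_le_one₀ (norm_nonneg _) hq.le)
  have hqn : ∀ k, q ^ k ≠ 0 := fun k => pow_ne_zero k hq0
  have hx0 : x ≠ 0 := by rintro rfl; simp at hx; exact hq0 hx.symm
  have hy0 : A * q ^ j ≠ 0 := mul_ne_zero hA0 (hqn j)
  have e1 : A * q ^ n * q⁻¹ * (c * q ^ j) * x = c := by
    have : A * q ^ n * q⁻¹ * (c * q ^ j) * x = c * q⁻¹ * (x * (A * q ^ j) * q ^ n) := by ring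
    rw [this, hx]; field_simp
  have key := qPfaffSaalschutz hq hq0 (A * q ^ n * q⁻¹) (c * q ^ j) x (n := n)
    (by rw [e1]; exact fun k _ => one_sub_mul_pow_ne_zero hc hq k)
  rw [e1] at key
  rw [← key, mul_sum]
  refine sum_congr rfl ?_
  rintro ⟨k, m⟩ hp
  have hkm : m + k = n := by rw [add_comm]; simpa using hp
  have r := qPoch_reverse k m hq0 (hkm ▸ hx)
  rw [hkm] at r
  have a1 : qPoch x q m ≠ 0 := fun h0 => qPoch_ne_zero hAj hq n (by rw [r, h0, mul_zero])
  have a2 := qPoch_ne_zero hAj hq k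
  have a3 := qPoch_ne_zero hA hq j
  have a4 := qPoch_ne_zero hq hq m
  have a5 := qPoch_ne_zero hq hq k
  have a6 := qPoch_ne_zero hc hq k
  have hxk : x ^ k * ((A * q ^ j) ^ k * ((q ^ k.choose 2) ^ 2 * q ^ (k * m))) = 1 := by
    have h1 : x ^ k * (A * q ^ j) ^ k * (q ^ n) ^ k = q ^ k := by
      rw [← mul_pow, ← mul_pow, hx]
    have h2 : (q ^ n) ^ k = (q ^ k.choose 2) ^ 2 * q ^ k * q ^ (k * m) := by
      rw [← pow_mul, ← hkm, add_mul, pow_add, pow_mul_self_eq, mul_comm m k]; ring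
    rw [h2] at h1
    refine mul_right_cancel₀ (hqn k) ?_
    linear_combination h1
  simp only [twoPhiOneCoeff]
  rw [add_comm k j, add_comm n j, qPoch_add A, qPoch_add A, qPoch_add c, r, ← hkm,
    pow_choose_two_add, neg_pow (A * q ^ j)]
  have s2 : ((-1 : ℂ) ^ m) * (-1) ^ m = 1 := by rw [← mul_pow]; simp
  rw [mul_comm m k]
  simp only [pow_add]
  generalize A * q ^ j = y at *
  have ym : y ^ m ≠ 0 := pow_ne_zero _ hy0
  have sm : ((-1 : ℂ) ^ m) ≠ 0 := by simp
  generalize (-1 : ℂ) ^ m = sm at *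
  have Z1 := hqn (k * m)
  have Z2 := hqn (k.choose 2)
  have Z3 := hqn (m.choose 2)
  generalize q ^ (k * m) = z1, q ^ (k.choose 2) = z2, q ^ (m.choose 2) = z3 at *
  generalize x ^ k = xk, y ^ k = yk, y ^ m = ym at *
  generalize qPoch (A * (q ^ m * q ^ k) * q⁻¹) q k = P1, qPoch c q j = P2,
    qPoch (c * q ^ j) q k = P3, qPoch c q k = P4, qPoch x q m = P5, qPoch q q m = P6,
    qPoch q q k = P7, qPoch y q k = P8, qPoch A q j = P9 at *
  field_simp
  linear_combination -(P1 * P2 * P3) * hxk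

theorem qPoch_eq_zero_of_lt {v q : ℂ} {j n : ℕ} (h : v * q ^ j = 1) (hj : j < n) :
    qPoch v q n = 0 :=
  Finset.prod_eq_zero (Finset.mem_range.mpr hj) (by rw [h, sub_self])

-- Divided by the total mass, this is the integral of P_n against (t₂z, t₂/z; q)_j: P_n is
-- orthogonal to every lower basis element.
open Finset in
theorem sum_awCoeff_mul_awMoment {q : ℂ} (hq : ‖q‖ < 1) (hq0 : q ≠ 0) {t₁ t₂ t₃ t₄ : ℂ}
    (h₁ : ‖t₁‖ < 1) (h₂ : ‖t₂‖ < 1) (h₃ : ‖t₃‖ < 1) (h₄ : ‖t₄‖ < 1)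
    (n₁ : t₁ ≠ 0) (n₂ : t₂ ≠ 0) (n₃ : t₃ ≠ 0) (n₄ : t₄ ≠ 0) {n j : ℕ} (hj : j ≤ n) :
    ∑ p ∈ antidiagonal n, awCoeff t₁ t₂ t₃ t₄ q n p.1 * awMoment t₁ t₂ t₃ t₄ q p.1 j =
      if j = n then (-1) ^ n * (t₂ ^ n * q ^ n.choose 2) *
        (qPoch (t₁ * t₃) q n * qPoch (t₁ * t₄) q n * (qPoch (t₂ * t₃) q n * qPoch (t₂ * t₄) q n)) /
          qPoch (t₁ * t₂ * t₃ * t₄) q (2 * n)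
      else 0 := by
  have alg : ∀ B D s z a e f g y₁ y₂ y₃ y₄ E : ℂ, y₁ ≠ 0 → y₂ ≠ 0 →
      B / D * (s * z * a / (e * (f * g * y₁ * y₂))) * (y₄ * (y₁ * y₂) * E / y₃) =
      B / D * E * (s * z * a * y₄ / (e * f * g * y₃)) := by
    intros; field_simp
  have alg' : ∀ T₁ T₂ T₃ T₄ z B C Q s y₁ y₂ y₃ y₄ : ℂ, s * s = 1 → T₁ ≠ 0 → T₃ ≠ 0 → T₄ ≠ 0 →
      z ≠ 0 → Q ≠ 0 → s ≠ 0 → y₁ ≠ 0 → y₂ ≠ 0 → y₃ ≠ 0 →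
      (T₁ * z)⁻¹ * B / (s * (T₃ * T₄) * z * y₂) * C *
        (y₃ / y₄ * (s * (T₁ * T₂ * T₃ * T₄ * (z ^ 2 * Q)) * z ^ 2) *
          (y₁ * y₂ / (s * Q * z * y₁ * y₃))) =
      s * (T₂ * z) * (B * C) / y₄ := by
    intro T₁ T₂ T₃ T₄ z B C Q s y₁ y₂ y₃ y₄ hs _ _ _ _ _ _ _ _ _
    field_simp
    linear_combination -(B * C * T₂ / y₄) * hs
  have h12 := norm_mul_lt_one h₁ h₂
  have h13 := norm_mul_lt_one h₁ h₃
  have h14 := norm_mul_lt_one h₁ h₄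
  have h34 := norm_mul_lt_one h₃ h₄
  have hA : ‖t₁ * t₂ * t₃ * t₄‖ < 1 := norm_mul_lt_one (norm_mul_lt_one h12 h₃) h₄
  have hA0 : t₁ * t₂ * t₃ * t₄ ≠ 0 := by positivity
  have hqn : ∀ k, q ^ k ≠ 0 := fun k => pow_ne_zero k hq0
  have hqj := hqn j
  have hqn' := hqn n
  set x := q * (t₁ * t₂ * t₃ * t₄ * q ^ j * q ^ n)⁻¹ with hx
  have hx1 : x * (t₁ * t₂ * t₃ * t₄ * q ^ j) * q ^ n = q := by rw [hx]; field_simp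
  have key := sum_awCoeff_mul_awMoment_aux hq hq0 hA hA0 h12 n j hx1
  have hterm : ∀ p ∈ antidiagonal n,
      awCoeff t₁ t₂ t₃ t₄ q n p.1 * awMoment t₁ t₂ t₃ t₄ q p.1 j =
      (t₁ ^ n * q ^ n.choose 2)⁻¹ * (qPoch (t₁ * t₃) q n * qPoch (t₁ * t₄) q n) /
        qPoch (t₃ * t₄) q n * (qPoch (t₂ * t₃) q j * qPoch (t₂ * t₄) q j) *
      ((-1) ^ p.1 * q ^ p.2.choose 2 * qPoch (t₁ * t₂ * t₃ * t₄ * q ^ n * q⁻¹) q p.1 *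
        qPoch (t₁ * t₂) q (p.1 + j) / (qPoch q q p.2 * qPoch q q p.1 * qPoch (t₁ * t₂) q p.1 *
          qPoch (t₁ * t₂ * t₃ * t₄) q (p.1 + j))) := by
    rintro ⟨k, m⟩ hp
    have hkm : k + m = n := by simpa using hp
    have hm : n - k = m := by omega
    have a7 := qPoch_ne_zero h13 hq k
    have a8 := qPoch_ne_zero h14 hq k
    simp only [awCoeff, awMoment, hm]
    exact alg _ _ _ _ _ _ _ _ _ _ _ _ _ a7 a8
  rw [sum_congr rfl hterm, ← mul_sum, key]
  -- v = q^{-j}. Its shifted factorial of length n vanishes for j < n, while for j = n it reverses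
  -- to (q; q)_n.
  set v := t₁ * t₂ * t₃ * t₄ * q ^ n * q⁻¹ * x with hv
  have hv1 : v * q ^ j = 1 := by rw [hv, hx]; field_simp
  rcases hj.lt_or_eq with hlt | rfl
  · rw [if_neg hlt.ne, twoPhiOneCoeff, qPoch_eq_zero_of_lt hv1 hlt]
    ring
  rw [if_pos rfl]
  set w := t₁ * t₂ * q ^ j * x with hw
  have hw1 : w * (t₃ * t₄) * q ^ j = q := by rw [hw, hx]; field_simp
  have r1 := qPoch_reverse 0 j (u := v) (y := q) hq0
    (by rw [add_zero]; linear_combination q * hv1)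
  have r2 := qPoch_reverse 0 j (u := w) hq0 (by simpa using hw1)
  simp only [add_zero, zero_mul, zero_add, qPoch_zero, one_mul] at r1 r2
  have a1 : qPoch v q j ≠ 0 := fun h0 => qPoch_ne_zero hq hq j (by rw [r1, h0, mul_zero])
  have a2 : qPoch w q j ≠ 0 := fun h0 => qPoch_ne_zero h34 hq j (by rw [r2, h0, mul_zero])
  have a3 := qPoch_ne_zero h12 hq j
  have a4 := qPoch_ne_zero hA hq (2 * j)
  have hqq : (q ^ j) ^ j = (q ^ j.choose 2) ^ 2 * q ^ j := by rw [← pow_mul, pow_mul_self_eq]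
  rw [twoPhiOneCoeff, r1, r2, ← two_mul, mul_pow (t₁ * t₂ * t₃ * t₄), hqq, neg_pow q,
    neg_pow (t₃ * t₄)]
  have s2 : ((-1 : ℂ) ^ j) * (-1) ^ j = 1 := by rw [← mul_pow]; simp
  simp only [mul_pow]
  exact alg' _ _ _ _ _ _ _ _ _ _ _ _ _ s2 (pow_ne_zero j n₁) (pow_ne_zero j n₃)
    (pow_ne_zero j n₄) (hqn _) hqj (by simp) a1 a2 a3

-- The two polynomials are expanded in different bases, with t₁ for degree n and t₂ for degree m,
-- because the mixed moments have a product form. For m = n only the top coefficient of the second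
-- expansion contributes.
open Finset in
theorem sum_sum_awCoeff_mul_awMoment {q : ℂ} (hq : ‖q‖ < 1) (hq0 : q ≠ 0) {t₁ t₂ t₃ t₄ : ℂ}
    (h₁ : ‖t₁‖ < 1) (h₂ : ‖t₂‖ < 1) (h₃ : ‖t₃‖ < 1) (h₄ : ‖t₄‖ < 1)
    (n₁ : t₁ ≠ 0) (n₂ : t₂ ≠ 0) (n₃ : t₃ ≠ 0) (n₄ : t₄ ≠ 0) {n m : ℕ} (hmn : m ≤ n) :
    ∑ p ∈ antidiagonal n, ∑ r ∈ antidiagonal m, awCoeff t₁ t₂ t₃ t₄ q n p.1 *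
        awCoeff t₂ t₁ t₃ t₄ q m r.1 * awMoment t₁ t₂ t₃ t₄ q p.1 r.1 =
      if m = n then awNorm t₁ t₂ t₃ t₄ q n else 0 := by
  have hterm : ∀ r ∈ antidiagonal m, ∑ p ∈ antidiagonal n, awCoeff t₁ t₂ t₃ t₄ q n p.1 *
        awCoeff t₂ t₁ t₃ t₄ q m r.1 * awMoment t₁ t₂ t₃ t₄ q p.1 r.1 =
      awCoeff t₂ t₁ t₃ t₄ q m r.1 * if r.1 = n then
        (-1) ^ n * (t₂ ^ n * q ^ n.choose 2) *
        (qPoch (t₁ * t₃) q n * qPoch (t₁ * t₄) q n * (qPoch (t₂ * t₃) q n * qPoch (t₂ * t₄) q n)) /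
          qPoch (t₁ * t₂ * t₃ * t₄) q (2 * n)
      else 0 := fun r hr => by
    have hr' : r.1 + r.2 = m := by simpa using hr
    rw [← sum_awCoeff_mul_awMoment hq hq0 h₁ h₂ h₃ h₄ n₁ n₂ n₃ n₄ (by omega), mul_sum]
    exact sum_congr rfl fun p _ => by ring
  rw [sum_comm, sum_congr rfl hterm]
  rcases hmn.lt_or_eq with hlt | rfl
  · rw [if_neg hlt.ne]
    refine sum_eq_zero fun r hr => ?_
    have hr' : r.1 + r.2 = m := by simpa using hr
    rw [if_neg (by omega), mul_zero]
  rw [if_pos rfl, sum_eq_single (m, 0)]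
  · rw [if_pos rfl]
    have a1 := qPoch_ne_zero (norm_mul_lt_one h₂ h₃) hq m
    have a2 := qPoch_ne_zero (norm_mul_lt_one h₂ h₄) hq m
    have Z := pow_ne_zero (m.choose 2) hq0
    have w2 := pow_ne_zero m n₂
    have s2 : ((-1 : ℂ) ^ m) * (-1) ^ m = 1 := by rw [← mul_pow]; simp
    have alg : ∀ T z B D s a f g y₁ y₂ E G : ℂ, s * s = 1 → T ≠ 0 → z ≠ 0 → y₁ ≠ 0 → y₂ ≠ 0 →
        (T * z)⁻¹ * (y₁ * y₂) / D * (s * 1 * a / (1 * (f * g * y₁ * y₂))) *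
          (s * (T * z) * (B * E * (y₁ * y₂)) / G) =
        B * E * y₁ * y₂ * a / (G * D * f * g) := by
      intro T z B D s a f g y₁ y₂ E G hs _ _ _ _
      field_simp
      linear_combination (a * B * E / (D * f * g * G)) * hs
    simp only [awCoeff, awNorm, Nat.sub_self, qPoch_zero, mul_comm t₂ t₁, Nat.choose_zero_succ,
      pow_zero]
    exact alg _ _ _ _ _ _ _ _ _ _ _ _ s2 w2 Z a1 a2
  · rintro ⟨k, l⟩ hr hne
    have hr' : k + l = m := by simpa using hr
    have hk : k ≠ m := by rintro rfl; exact hne (by simp; omega)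
    simp only [if_neg hk, mul_zero]
  · intro h; simp at h

/-! ### Infinite q-shifted factorials. -/

theorem summable_norm_qPochInf (a : ℂ) {q : ℂ} (hq : ‖q‖ < 1) :
    Summable fun k : ℕ => ‖-(a * q ^ k)‖ := by
  simp only [norm_neg, norm_mul, norm_pow]
  exact (summable_geometric_of_lt_one (norm_nonneg q) hq).mul_left _

theorem qPochInf_ne_zero {a q : ℂ} (ha : ‖a‖ < 1) (hq : ‖q‖ < 1) : qPochInf a q ≠ 0 := by
  have := tprod_one_add_ne_zero_of_summable (f := fun k : ℕ => -(a * q ^ k))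
    (fun k => by simpa [sub_eq_add_neg] using one_sub_mul_pow_ne_zero ha hq k)
    (summable_norm_qPochInf a hq)
  simpa [qPochInf, sub_eq_add_neg] using this

theorem differentiable_qPochInf {q : ℂ} (hq : ‖q‖ < 1) :
    Differentiable ℂ fun a => qPochInf a q := by
  intro a
  have h := Summable.hasProdLocallyUniformlyOn_nat_one_add (f := fun (k : ℕ) (a : ℂ) => -(a * q ^ k))
    (K := Metric.ball 0 (‖a‖ + 1)) Metric.isOpen_ball
    ((summable_geometric_of_lt_one (norm_nonneg q) hq).mul_left (‖a‖ + 1))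
    (Filter.Eventually.of_forall fun k x hx => by
      rw [norm_neg, norm_mul, norm_pow]
      have : ‖x‖ < ‖a‖ + 1 := by simpa using hx
      gcongr)
    (fun k => by fun_prop)
  have h1 : (fun a => qPochInf a q) = fun x => ∏' i : ℕ, (1 + -(x * q ^ i)) := by
    ext x; simp [qPochInf, sub_eq_add_neg]
  rw [h1]
  have h2 := TendstoLocallyUniformlyOn.differentiableOn h
    (Filter.Eventually.of_forall fun s => by fun_prop) Metric.isOpen_ball
  exact h2.differentiableAt (Metric.isOpen_ball.mem_nhds (by simp))

theorem qPochInf_eq_mul (a : ℂ) {q : ℂ} (hq : ‖q‖ < 1) :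
    qPochInf a q = (1 - a) * qPochInf (a * q) q := by
  have e : ∀ k : ℕ, 1 - a * q ^ (k + 1) = 1 - a * q * q ^ k := fun k => by ring
  have h : Multipliable fun k : ℕ => 1 - a * q ^ (k + 1) := by
    simp only [e]; exact multipliable_qPochInf (a * q) hq
  have h2 := tprod_eq_zero_mul' (f := fun k : ℕ => 1 - a * q ^ k) h
  simp only [e, pow_zero, mul_one] at h2
  exact h2

theorem qPochInf_eq_qPoch_mul (a : ℂ) {q : ℂ} (hq : ‖q‖ < 1) (n : ℕ) :
    qPochInf a q = qPoch a q n * qPochInf (a * q ^ n) q := by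
  induction n with
  | zero => simp [qPoch_zero]
  | succ n ih =>
    rw [ih, qPochInf_eq_mul (a * q ^ n) hq, qPoch_succ, pow_succ]
    ring_nf

theorem norm_sq_lt_one {q : ℂ} (hq : ‖q‖ < 1) : ‖q ^ 2‖ < 1 := by
  rw [pow_two]; exact norm_mul_lt_one hq hq

theorem qPochInf_even_mul_odd (a : ℂ) {q : ℂ} (hq : ‖q‖ < 1) :
    qPochInf a (q ^ 2) * qPochInf (a * q) (q ^ 2) = qPochInf a q := by
  have he : Multipliable fun k : ℕ => 1 - a * q ^ (2 * k) := by
    simpa [pow_mul] using multipliable_qPochInf a (norm_sq_lt_one hq)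
  have ho : Multipliable fun k : ℕ => 1 - a * q ^ (2 * k + 1) := by
    simpa [pow_mul, pow_succ', mul_assoc] using multipliable_qPochInf (a * q) (norm_sq_lt_one hq)
  have := tprod_even_mul_odd (f := fun k => 1 - a * q ^ k) he ho
  simpa [qPochInf, pow_mul, pow_succ', mul_assoc] using this

theorem qPochInf_mul_neg (a : ℂ) {q : ℂ} (hq : ‖q‖ < 1) :
    qPochInf a q * qPochInf (-a) q = qPochInf (a ^ 2) (q ^ 2) := by
  rw [qPochInf, qPochInf, ← Multipliable.tprod_mul (multipliable_qPochInf a hq)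
    (multipliable_qPochInf (-a) hq), qPochInf]
  refine tprod_congr fun k => ?_
  ring

/-- Euler's identity `(-q; q)_∞ (q; q²)_∞ = 1`. -/
theorem qPochInf_neg_mul_qPochInf_sq {q : ℂ} (hq : ‖q‖ < 1) :
    qPochInf (-q) q * qPochInf q (q ^ 2) = 1 := by
  have h1 := qPochInf_mul_neg q hq
  have h2 := qPochInf_even_mul_odd q hq
  rw [← h2, ← pow_two] at h1
  have h3 := qPochInf_ne_zero (norm_sq_lt_one hq) (norm_sq_lt_one hq)
  refine mul_right_cancel₀ h3 ?_
  linear_combination h1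

/-! ### The weight on the unit circle. -/

/-- The Askey–Wilson weight as a function of `z = e^{iθ}`. -/
noncomputable def awWeight (t₁ t₂ t₃ t₄ q z : ℂ) : ℂ :=
  qPochInf (z ^ 2) q * qPochInf (z⁻¹ ^ 2) q /
    (qPochInf (t₁ * z) q * qPochInf (t₁ * z⁻¹) q * (qPochInf (t₂ * z) q * qPochInf (t₂ * z⁻¹) q) *
      (qPochInf (t₃ * z) q * qPochInf (t₃ * z⁻¹) q) * (qPochInf (t₄ * z) q * qPochInf (t₄ * z⁻¹) q))

theorem expNegI_eq_inv (θ : ℝ) : expNegI θ = (expI θ)⁻¹ := by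
  rw [expNegI, expI, Complex.exp_neg]

theorem norm_expI (θ : ℝ) : ‖expI θ‖ = 1 := by
  rw [expI, mul_comm, Complex.norm_exp_ofReal_mul_I]

theorem expI_ne_zero (θ : ℝ) : expI θ ≠ 0 := Complex.exp_ne_zero _

theorem continuous_expI : Continuous expI := by
  unfold expI; fun_prop

theorem expI_add_two_pi (θ : ℝ) : expI (θ + 2 * Real.pi) = expI θ := by
  rw [expI, expI]
  push_cast
  rw [mul_add, show Complex.I * (2 * (Real.pi : ℂ)) = 2 * Real.pi * Complex.I by ring,
    Complex.exp_periodic]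

theorem expI_two_pi_sub (θ : ℝ) : expI (2 * Real.pi - θ) = (expI θ)⁻¹ := by
  rw [← expNegI_eq_inv, sub_eq_add_neg, add_comm, expI_add_two_pi]
  simp [expI, expNegI]

theorem askeyWilsonWeight_eq (t₁ t₂ t₃ t₄ q : ℂ) (θ : ℝ) :
    askeyWilsonWeight t₁ t₂ t₃ t₄ q θ = awWeight t₁ t₂ t₃ t₄ q (expI θ) := by
  simp [askeyWilsonWeight, awWeight, qPochsInf, expNegI_eq_inv]

theorem awWeight_inv (t₁ t₂ t₃ t₄ q z : ℂ) :
    awWeight t₁ t₂ t₃ t₄ q z⁻¹ = awWeight t₁ t₂ t₃ t₄ q z := by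
  simp only [awWeight, inv_inv, mul_comm (qPochInf (_ * z) q), mul_comm (qPochInf (z ^ 2) q)]

/-- Rotation brings any parameter into the first slot, so the q-shift needs to be studied for t₁
only. -/
theorem awWeight_rotate (t₁ t₂ t₃ t₄ q z : ℂ) :
    awWeight t₁ t₂ t₃ t₄ q z = awWeight t₂ t₃ t₄ t₁ q z := by
  simp only [awWeight]
  congr 1
  ring

theorem norm_mul_circle_lt {t z : ℂ} (ht : ‖t‖ < 1) (hz : ‖z‖ = 1) : ‖t * z‖ < 1 := by
  rwa [norm_mul, hz, mul_one]

theorem norm_inv_circle {z : ℂ} (hz : ‖z‖ = 1) : ‖z⁻¹‖ = 1 := by rw [norm_inv, hz, inv_one]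

theorem awWeight_mul_q {t₁ q z : ℂ} (t₂ t₃ t₄ : ℂ) (hq : ‖q‖ < 1) (h₁ : ‖t₁‖ < 1)
    (hz : ‖z‖ = 1) :
    awWeight (t₁ * q) t₂ t₃ t₄ q z =
      (1 - t₁ * z) * (1 - t₁ * z⁻¹) * awWeight t₁ t₂ t₃ t₄ q z := by
  have h1 := one_sub_mul_pow_ne_zero (norm_mul_circle_lt h₁ hz) hq 0
  have h2 := one_sub_mul_pow_ne_zero (norm_mul_circle_lt h₁ (norm_inv_circle hz)) hq 0
  rw [pow_zero, mul_one] at h1 h2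
  rw [awWeight, awWeight, qPochInf_eq_mul (t₁ * z) hq, qPochInf_eq_mul (t₁ * z⁻¹) hq,
    mul_right_comm t₁ q z, mul_right_comm t₁ q z⁻¹]
  have alg : ∀ a b N x y D₂ D₃ D₄ : ℂ, a ≠ 0 → b ≠ 0 → N / (x * y * D₂ * D₃ * D₄) =
      a * b * (N / (a * x * (b * y) * D₂ * D₃ * D₄)) := by
    intros; field_simp
  exact alg _ _ _ _ _ _ _ _ h1 h2

theorem awWeight_mul_q_pow {t₁ q z : ℂ} (t₂ t₃ t₄ : ℂ) (hq : ‖q‖ < 1) (h₁ : ‖t₁‖ < 1)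
    (hz : ‖z‖ = 1) (k : ℕ) :
    awWeight (t₁ * q ^ k) t₂ t₃ t₄ q z =
      qPoch (t₁ * z) q k * qPoch (t₁ * z⁻¹) q k * awWeight t₁ t₂ t₃ t₄ q z := by
  induction k with
  | zero => simp [qPoch_zero]
  | succ k ih =>
    have hk : ‖t₁ * q ^ k‖ < 1 := by
      rw [norm_mul, norm_pow]
      exact mul_lt_one_of_nonneg_of_lt_one_left (norm_nonneg _) h₁
        (pow_le_one₀ (norm_nonneg _) hq.le)
    rw [pow_succ, ← mul_assoc, awWeight_mul_q _ _ _ hq hk hz, ih, qPoch_succ, qPoch_succ]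
    ring

/-- The arbitrary space Y covers continuity in θ, continuity in t₁ on the disc, and joint
perturbation of all four parameters. -/
theorem continuous_awWeight {Y : Type*} [TopologicalSpace Y] {q : ℂ} (hq : ‖q‖ < 1)
    {t₁ t₂ t₃ t₄ z : Y → ℂ} (c₁ : Continuous t₁) (c₂ : Continuous t₂) (c₃ : Continuous t₃)
    (c₄ : Continuous t₄) (cz : Continuous z) (h₁ : ∀ y, ‖t₁ y‖ < 1) (h₂ : ∀ y, ‖t₂ y‖ < 1)
    (h₃ : ∀ y, ‖t₃ y‖ < 1) (h₄ : ∀ y, ‖t₄ y‖ < 1) (hz : ∀ y, ‖z y‖ = 1) :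
    Continuous fun y => awWeight (t₁ y) (t₂ y) (t₃ y) (t₄ y) q (z y) := by
  have hz0 : ∀ y, z y ≠ 0 := fun y h => by simpa [h] using hz y
  have czi : Continuous fun y => (z y)⁻¹ := cz.inv₀ hz0
  have hp := (differentiable_qPochInf hq).continuous
  have hne : ∀ (t : Y → ℂ) (_ : ∀ y, ‖t y‖ < 1) (y : Y),
      qPochInf (t y * z y) q * qPochInf (t y * (z y)⁻¹) q ≠ 0 := fun t ht y =>
    mul_ne_zero (qPochInf_ne_zero (norm_mul_circle_lt (ht y) (hz y)) hq)
      (qPochInf_ne_zero (norm_mul_circle_lt (ht y) (norm_inv_circle (hz y))) hq)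
  have hc : ∀ (f : Y → ℂ), Continuous f → Continuous fun y => qPochInf (f y) q :=
    fun f hf => hp.comp hf
  have hcp : ∀ (t : Y → ℂ), Continuous t →
      Continuous fun y => qPochInf (t y * z y) q * qPochInf (t y * (z y)⁻¹) q := fun t ht =>
    (hc _ (ht.mul cz)).mul (hc _ (ht.mul czi))
  unfold awWeight
  refine Continuous.div ((hc _ (cz.pow 2)).mul (hc _ (czi.pow 2)))
    ((((hcp _ c₁).mul (hcp _ c₂)).mul (hcp _ c₃)).mul (hcp _ c₄)) fun y => ?_
  exact mul_ne_zero (mul_ne_zero (mul_ne_zero (hne _ h₁ y) (hne _ h₂ y)) (hne _ h₃ y)) (hne _ h₄ y)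

/-- The reflection θ ↦ 2π - θ passes between the half circle of the theorem and the full circle of
the contour argument. -/
theorem integral_zero_two_pi_of_inv {g : ℂ → ℂ} (hg : Continuous fun θ : ℝ => g (expI θ))
    (hinv : ∀ z, g z⁻¹ = g z) :
    ∫ θ in (0 : ℝ)..2 * Real.pi, g (expI θ) = 2 * ∫ θ in (0 : ℝ)..Real.pi, g (expI θ) := by
  have h : ∫ θ in Real.pi..2 * Real.pi, g (expI θ) = ∫ θ in (0 : ℝ)..Real.pi, g (expI θ) := by
    have := intervalIntegral.integral_comp_sub_left (a := 0) (b := Real.pi)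
      (fun θ : ℝ => g (expI θ)) (2 * Real.pi)
    simp only [expI_two_pi_sub, hinv] at this
    rw [this]; congr 1 <;> ring
  rw [← intervalIntegral.integral_add_adjacent_intervals (hg.intervalIntegrable 0 Real.pi)
    (hg.intervalIntegrable Real.pi (2 * Real.pi)), h]
  ring

/-! ### Contour shift and the first moment. -/

theorem circleMap_eq_expI (R θ : ℝ) : circleMap 0 R θ = R * expI θ := by
  simp [circleMap, expI, mul_comm]

theorem circleIntegral_inv_smul_eq (G : ℂ → ℂ) {R : ℝ} (hR : R ≠ 0) :
    (∮ z in C(0, R), (z - 0)⁻¹ • G z) =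
      Complex.I * ∫ θ in (0 : ℝ)..2 * Real.pi, G (R * expI θ) := by
  rw [circleIntegral, ← intervalIntegral.integral_const_mul]
  refine intervalIntegral.integral_congr fun θ _ => ?_
  have := circleMap_ne_center (c := 0) hR (θ := θ)
  simp only [deriv_circleMap, sub_zero, smul_eq_mul, ← circleMap_eq_expI]
  field_simp

/-- Cauchy's theorem for G(z) dz/z on the annulus |q| ≤ |z| ≤ 1. Multiplication by q is a scaling by
|q| followed by a rotation, which periodicity absorbs. -/
theorem integral_comp_mul_expI {q : ℂ} (hq0 : q ≠ 0) (hq : ‖q‖ < 1) {G : ℂ → ℂ}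
    (hG : ∀ z, ‖q‖ ≤ ‖z‖ → ‖z‖ ≤ 1 → DifferentiableAt ℂ G z) :
    ∫ θ in (0 : ℝ)..2 * Real.pi, G (q * expI θ) = ∫ θ in (0 : ℝ)..2 * Real.pi, G (expI θ) := by
  have hr : 0 < ‖q‖ := norm_pos_iff.mpr hq0
  have h := Complex.circleIntegral_sub_center_inv_smul_eq_of_differentiable_on_annulus_off_countable
    (c := 0) hr hq.le (f := G) (s := ∅) Set.countable_empty
    (fun z hz => (hG z (by simpa using hz.2) (by simpa using hz.1)).continuousAt.continuousWithinAt)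
    (fun z hz => hG z (by simpa using (not_le.mp fun h => hz.1.2 (by simpa using h)).le)
      (by simpa using (Metric.mem_ball.mp hz.1.1).le))
  rw [circleIntegral_inv_smul_eq G one_ne_zero, circleIntegral_inv_smul_eq G hr.ne'] at h
  have h' := mul_left_cancel₀ Complex.I_ne_zero h
  simp only [Complex.ofReal_one, one_mul] at h'
  rw [h']
  have e : ∀ θ : ℝ, q * expI θ = ‖q‖ * expI (θ + q.arg) := fun θ => by
    conv_lhs => rw [← Complex.norm_mul_exp_arg_mul_I q]
    rw [mul_assoc, expI, expI, ← Complex.exp_add]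
    push_cast
    ring_nf
  simp only [e]
  rw [intervalIntegral.integral_comp_add_right (fun θ : ℝ => G (‖q‖ * expI θ)), zero_add,
    add_comm (2 * Real.pi)]
  have hper : Function.Periodic (fun θ : ℝ => G (‖q‖ * expI θ)) (2 * Real.pi) := fun θ => by
    simp only [expI_add_two_pi]
  simpa using hper.intervalIntegral_add_eq q.arg 0

/-- The Askey–Wilson weight without the factor `(1 - z²)(1 - z⁻²)`. -/
noncomputable def awReducedWeight (t₁ t₂ t₃ t₄ q z : ℂ) : ℂ :=
  qPochInf (q * z ^ 2) q * qPochInf (q * z⁻¹ ^ 2) q /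
    (qPochInf (t₁ * z) q * qPochInf (t₁ * z⁻¹) q * (qPochInf (t₂ * z) q * qPochInf (t₂ * z⁻¹) q) *
      (qPochInf (t₃ * z) q * qPochInf (t₃ * z⁻¹) q) * (qPochInf (t₄ * z) q * qPochInf (t₄ * z⁻¹) q))

theorem awWeight_eq_reduced {q : ℂ} (hq : ‖q‖ < 1) (t₁ t₂ t₃ t₄ z : ℂ) :
    awWeight t₁ t₂ t₃ t₄ q z =
      (1 - z ^ 2) * (1 - z⁻¹ ^ 2) * awReducedWeight t₁ t₂ t₃ t₄ q z := by
  rw [awWeight, awReducedWeight, qPochInf_eq_mul (z ^ 2) hq, qPochInf_eq_mul (z⁻¹ ^ 2) hq,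
    mul_comm q, mul_comm q]
  ring

/-- The function whose integrals over `|z| = 1` and `|z| = |q|` are compared. -/
noncomputable def awContour (t₁ t₂ t₃ t₄ q z : ℂ) : ℂ :=
  z * (qPochInf (z ^ 2) q * qPochInf (q * z⁻¹ ^ 2) q) /
    (qPochInf (t₁ * z) q * qPochInf (q * t₁ * z⁻¹) q *
      (qPochInf (t₂ * z) q * qPochInf (q * t₂ * z⁻¹) q) *
      (qPochInf (t₃ * z) q * qPochInf (q * t₃ * z⁻¹) q) *
      (qPochInf (t₄ * z) q * qPochInf (q * t₄ * z⁻¹) q))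

/-- On the closed annulus both |t_j z| and |q t_j/z| are below 1, so no denominator vanishes. Having
q t_j/z in place of t_j/z moves the inner poles inside |z| = |q|. -/
theorem differentiableAt_awContour {q : ℂ} (hq0 : q ≠ 0) (hq : ‖q‖ < 1) {t₁ t₂ t₃ t₄ z : ℂ}
    (h₁ : ‖t₁‖ < 1) (h₂ : ‖t₂‖ < 1) (h₃ : ‖t₃‖ < 1) (h₄ : ‖t₄‖ < 1)
    (hz : ‖q‖ ≤ ‖z‖) (hz1 : ‖z‖ ≤ 1) : DifferentiableAt ℂ (awContour t₁ t₂ t₃ t₄ q) z := by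
  have hr : 0 < ‖z‖ := (norm_pos_iff.mpr hq0).trans_le hz
  have hz0 : z ≠ 0 := norm_pos_iff.mp hr
  have hp := differentiable_qPochInf hq
  have hc : ∀ f : ℂ → ℂ, DifferentiableAt ℂ f z → DifferentiableAt ℂ (fun z => qPochInf (f z) q) z :=
    fun f hf => (hp (f z)).comp z hf
  have hinv : DifferentiableAt ℂ (fun z : ℂ => z⁻¹) z := differentiableAt_inv hz0
  have hd : ∀ t : ℂ, DifferentiableAt ℂ
      (fun z => qPochInf (t * z) q * qPochInf (q * t * z⁻¹) q) z := fun t =>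
    (hc _ (by fun_prop)).mul (hc _ (hinv.const_mul _))
  have hne : ∀ t : ℂ, ‖t‖ < 1 → qPochInf (t * z) q * qPochInf (q * t * z⁻¹) q ≠ 0 := fun t ht => by
    refine mul_ne_zero (qPochInf_ne_zero ?_ hq) (qPochInf_ne_zero ?_ hq)
    · rw [norm_mul]; exact mul_lt_one_of_nonneg_of_lt_one_left (norm_nonneg _) ht hz1
    · rw [norm_mul, norm_mul, norm_inv, mul_comm ‖q‖, mul_assoc, ← div_eq_mul_inv]
      exact mul_lt_one_of_nonneg_of_lt_one_left (norm_nonneg _) ht ((div_le_one hr).mpr hz)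
  unfold awContour
  refine DifferentiableAt.div ?_ ((((hd t₁).mul (hd t₂)).mul (hd t₃)).mul (hd t₄)) ?_
  · exact differentiableAt_id.mul
      ((hc _ (by fun_prop)).mul (hc _ ((hinv.pow 2).const_mul _)))
  · exact mul_ne_zero (mul_ne_zero (mul_ne_zero (hne _ h₁) (hne _ h₂)) (hne _ h₃)) (hne _ h₄)

theorem one_sub_ne_zero_of_norm_lt {a : ℂ} (ha : ‖a‖ < 1) : 1 - a ≠ 0 := by
  intro h; rw [← sub_eq_zero.mp h] at ha; simp at ha

theorem awContour_eq {q : ℂ} (hq : ‖q‖ < 1) {t₁ t₂ t₃ t₄ z : ℂ}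
    (h₁ : ‖t₁‖ < 1) (h₂ : ‖t₂‖ < 1) (h₃ : ‖t₃‖ < 1) (h₄ : ‖t₄‖ < 1) (hz : ‖z‖ = 1) :
    awContour t₁ t₂ t₃ t₄ q z = z * (1 - z ^ 2) * ((1 - t₁ * z⁻¹) * (1 - t₂ * z⁻¹) *
      (1 - t₃ * z⁻¹) * (1 - t₄ * z⁻¹)) * awReducedWeight t₁ t₂ t₃ t₄ q z := by
  have hn : ∀ t : ℂ, ‖t‖ < 1 → 1 - t * z⁻¹ ≠ 0 := fun t ht =>
    one_sub_ne_zero_of_norm_lt (norm_mul_circle_lt ht (norm_inv_circle hz))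
  have hs : ∀ t : ℂ, qPochInf (t * z⁻¹) q = (1 - t * z⁻¹) * qPochInf (q * t * z⁻¹) q := fun t => by
    rw [qPochInf_eq_mul _ hq]; ring_nf
  rw [awContour, awReducedWeight, qPochInf_eq_mul (z ^ 2) hq, hs t₁, hs t₂, hs t₃, hs t₄,
    mul_comm (z ^ 2) q]
  have e₁ := hn t₁ h₁
  have e₂ := hn t₂ h₂
  have e₃ := hn t₃ h₃
  have e₄ := hn t₄ h₄
  have alg : ∀ Z Y N M a₁ a₂ a₃ a₄ x₁ x₂ x₃ x₄ y₁ y₂ y₃ y₄ : ℂ, a₁ ≠ 0 → a₂ ≠ 0 → a₃ ≠ 0 →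
      a₄ ≠ 0 → Z * (Y * N * M) / (x₁ * y₁ * (x₂ * y₂) * (x₃ * y₃) * (x₄ * y₄)) =
      Z * Y * (a₁ * a₂ * a₃ * a₄) * (N * M / (x₁ * (a₁ * y₁) * (x₂ * (a₂ * y₂)) *
        (x₃ * (a₃ * y₃)) * (x₄ * (a₄ * y₄)))) := by
    intro Z Y N M a₁ a₂ a₃ a₄ x₁ x₂ x₃ x₄ y₁ y₂ y₃ y₄ n₁ n₂ n₃ n₄
    rw [← mul_div_mul_left _ _ (mul_ne_zero (mul_ne_zero (mul_ne_zero n₁ n₂) n₃) n₄)]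
    ring
  exact alg _ _ _ _ _ _ _ _ _ _ _ _ _ _ _ _ e₁ e₂ e₃ e₄

theorem awContour_mul_q {q : ℂ} (hq0 : q ≠ 0) (hq : ‖q‖ < 1) {t₁ t₂ t₃ t₄ z : ℂ}
    (h₁ : ‖t₁‖ < 1) (h₂ : ‖t₂‖ < 1) (h₃ : ‖t₃‖ < 1) (h₄ : ‖t₄‖ < 1) (hz : ‖z‖ = 1) :
    awContour t₁ t₂ t₃ t₄ q (q * z) = -(z⁻¹ * (1 - z⁻¹ ^ 2) * ((1 - t₁ * z) * (1 - t₂ * z) *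
      (1 - t₃ * z) * (1 - t₄ * z)) * awReducedWeight t₁ t₂ t₃ t₄ q z) := by
  have hz0 : z ≠ 0 := by rintro rfl; simp at hz
  have hn : ∀ t : ℂ, ‖t‖ < 1 → 1 - t * z ≠ 0 := fun t ht =>
    one_sub_ne_zero_of_norm_lt (norm_mul_circle_lt ht hz)
  have hs : ∀ t : ℂ, qPochInf (t * z) q = (1 - t * z) * qPochInf (t * (q * z)) q := fun t => by
    rw [qPochInf_eq_mul _ hq]; ring_nf
  have hi : ∀ t : ℂ, q * t * (q * z)⁻¹ = t * z⁻¹ := fun t => by field_simp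
  have h5 : qPochInf (q * z ^ 2) q = (1 - q * z ^ 2) * qPochInf ((q * z) ^ 2) q := by
    rw [qPochInf_eq_mul _ hq]; ring_nf
  have h6 : qPochInf (q * (q * z)⁻¹ ^ 2) q =
      (1 - q⁻¹ * z⁻¹ ^ 2) * ((1 - z⁻¹ ^ 2) * qPochInf (q * z⁻¹ ^ 2) q) := by
    have e : q * (q * z)⁻¹ ^ 2 = q⁻¹ * z⁻¹ ^ 2 := by field_simp
    have e' : q⁻¹ * z⁻¹ ^ 2 * q = z⁻¹ ^ 2 := by field_simp
    rw [e, qPochInf_eq_mul _ hq, e', qPochInf_eq_mul (z⁻¹ ^ 2) hq, mul_comm (z⁻¹ ^ 2) q]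
  have h7 : q * z * (1 - q⁻¹ * z⁻¹ ^ 2) = -(z⁻¹ * (1 - q * z ^ 2)) := by field_simp; ring
  rw [awContour, awReducedWeight, hs t₁, hs t₂, hs t₃, hs t₄, hi, hi, hi, hi, h5, h6]
  have e₁ := hn t₁ h₁
  have e₂ := hn t₂ h₂
  have e₃ := hn t₃ h₃
  have e₄ := hn t₄ h₄
  have alg : ∀ Z W X Y V N M a₁ a₂ a₃ a₄ x₁ x₂ x₃ x₄ y₁ y₂ y₃ y₄ : ℂ, a₁ ≠ 0 → a₂ ≠ 0 → a₃ ≠ 0 →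
      a₄ ≠ 0 → Z * W = -(X * Y) → Z * (N * (W * (V * M))) /
        (x₁ * y₁ * (x₂ * y₂) * (x₃ * y₃) * (x₄ * y₄)) =
      -(X * V * (a₁ * a₂ * a₃ * a₄) * (Y * N * M / (a₁ * x₁ * y₁ * (a₂ * x₂ * y₂) *
        (a₃ * x₃ * y₃) * (a₄ * x₄ * y₄)))) := by
    intro Z W X Y V N M a₁ a₂ a₃ a₄ x₁ x₂ x₃ x₄ y₁ y₂ y₃ y₄ n₁ n₂ n₃ n₄ h
    have : Z * (N * (W * (V * M))) = -(X * Y) * (N * (V * M)) := by rw [← h]; ring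
    rw [this, ← mul_div_mul_left _ _ (mul_ne_zero (mul_ne_zero (mul_ne_zero n₁ n₂) n₃) n₄)]
    ring
  exact alg _ _ _ _ _ _ _ _ _ _ _ _ _ _ _ _ _ _ _ e₁ e₂ e₃ e₄ h7

/-- The total mass of the Askey–Wilson weight on `[0, π]`. -/
noncomputable def awIntegral (t₁ t₂ t₃ t₄ q : ℂ) : ℂ :=
  ∫ θ in (0 : ℝ)..Real.pi, awWeight t₁ t₂ t₃ t₄ q (expI θ)

theorem continuous_awWeight_expI {q : ℂ} (hq : ‖q‖ < 1) {t₁ t₂ t₃ t₄ : ℂ}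
    (h₁ : ‖t₁‖ < 1) (h₂ : ‖t₂‖ < 1) (h₃ : ‖t₃‖ < 1) (h₄ : ‖t₄‖ < 1) :
    Continuous fun θ : ℝ => awWeight t₁ t₂ t₃ t₄ q (expI θ) :=
  continuous_awWeight hq continuous_const continuous_const continuous_const continuous_const
    continuous_expI (fun _ => h₁) (fun _ => h₂) (fun _ => h₃) (fun _ => h₄) norm_expI

theorem continuous_expI_inv : Continuous fun θ : ℝ => (expI θ)⁻¹ :=
  continuous_expI.inv₀ expI_ne_zero

/-- The difference of `awContour` at z and at qz is (1 - z²)(1 - z⁻²) times the reduced weight times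
a symmetric factor. That factor is linear in z + 1/z, with elementary symmetric functions of the t_j
as coefficients. -/
theorem integral_awWeight_first_moment {q : ℂ} (hq0 : q ≠ 0) (hq : ‖q‖ < 1) {t₁ t₂ t₃ t₄ : ℂ}
    (h₁ : ‖t₁‖ < 1) (h₂ : ‖t₂‖ < 1) (h₃ : ‖t₃‖ < 1) (h₄ : ‖t₄‖ < 1) :
    ∫ θ in (0 : ℝ)..Real.pi, ((1 - t₁ * t₂ * t₃ * t₄) * (expI θ + (expI θ)⁻¹) -
      (t₁ + t₂ + t₃ + t₄) + (t₁ * t₂ * t₃ + t₁ * t₂ * t₄ + t₁ * t₃ * t₄ + t₂ * t₃ * t₄)) *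
        awWeight t₁ t₂ t₃ t₄ q (expI θ) = 0 := by
  have h := integral_comp_mul_expI hq0 hq (G := awContour t₁ t₂ t₃ t₄ q)
    fun z hz hz1 => differentiableAt_awContour hq0 hq h₁ h₂ h₃ h₄ hz hz1
  have hd : ∀ z : ℂ, ‖q‖ ≤ ‖z‖ → ‖z‖ ≤ 1 → ContinuousAt (awContour t₁ t₂ t₃ t₄ q) z :=
    fun z hz hz1 => (differentiableAt_awContour hq0 hq h₁ h₂ h₃ h₄ hz hz1).continuousAt
  have c1 : Continuous fun θ : ℝ => awContour t₁ t₂ t₃ t₄ q (q * expI θ) :=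
    continuous_iff_continuousAt.mpr fun θ =>
      ContinuousAt.comp (f := fun θ : ℝ => q * expI θ)
        (hd _ (by simp [norm_expI]) (by simp [norm_expI, hq.le]))
        (continuous_const.mul continuous_expI).continuousAt
  have c2 : Continuous fun θ : ℝ => awContour t₁ t₂ t₃ t₄ q (expI θ) :=
    continuous_iff_continuousAt.mpr fun θ =>
      ContinuousAt.comp (f := expI) (hd _ (by simp [norm_expI, hq.le]) (by simp [norm_expI]))
        continuous_expI.continuousAt
  have h2 := sub_eq_zero.mpr h.symm
  rw [← intervalIntegral.integral_sub (c2.intervalIntegrable _ _) (c1.intervalIntegrable _ _)] at h2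
  have hc : Continuous fun θ : ℝ => ((1 - t₁ * t₂ * t₃ * t₄) * (expI θ + (expI θ)⁻¹) -
      (t₁ + t₂ + t₃ + t₄) + (t₁ * t₂ * t₃ + t₁ * t₂ * t₄ + t₁ * t₃ * t₄ + t₂ * t₃ * t₄)) *
        awWeight t₁ t₂ t₃ t₄ q (expI θ) := by
    refine Continuous.mul ?_ (continuous_awWeight_expI hq h₁ h₂ h₃ h₄)
    have := continuous_expI
    have := continuous_expI_inv
    fun_prop
  have h3 := integral_zero_two_pi_of_inv (g := fun z => ((1 - t₁ * t₂ * t₃ * t₄) * (z + z⁻¹) -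
      (t₁ + t₂ + t₃ + t₄) + (t₁ * t₂ * t₃ + t₁ * t₂ * t₄ + t₁ * t₃ * t₄ + t₂ * t₃ * t₄)) *
        awWeight t₁ t₂ t₃ t₄ q z) hc
    (fun z => by simp only [inv_inv, awWeight_inv, add_comm z⁻¹ z])
  have h4 : ∫ θ in (0 : ℝ)..2 * Real.pi, ((1 - t₁ * t₂ * t₃ * t₄) * (expI θ + (expI θ)⁻¹) -
      (t₁ + t₂ + t₃ + t₄) + (t₁ * t₂ * t₃ + t₁ * t₂ * t₄ + t₁ * t₃ * t₄ + t₂ * t₃ * t₄)) *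
        awWeight t₁ t₂ t₃ t₄ q (expI θ) = 0 := by
    rw [← h2]
    refine intervalIntegral.integral_congr fun θ _ => ?_
    have hz0 := expI_ne_zero θ
    have hz := norm_expI θ
    simp only [awContour_eq hq h₁ h₂ h₃ h₄ hz, awContour_mul_q hq0 hq h₁ h₂ h₃ h₄ hz,
      awWeight_eq_reduced hq]
    generalize expI θ = z at *
    generalize awReducedWeight t₁ t₂ t₃ t₄ q z = w
    field_simp
    ring
  rw [h4] at h3
  simpa using h3.symm

/-- Shifting t₁ multiplies the weight by 1 + t₁² - t₁(z + 1/z), and the integral of z + 1/z is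
eliminated by the first moment. -/
theorem awIntegral_mul_q {q : ℂ} (hq0 : q ≠ 0) (hq : ‖q‖ < 1) {t₁ t₂ t₃ t₄ : ℂ}
    (h₁ : ‖t₁‖ < 1) (h₂ : ‖t₂‖ < 1) (h₃ : ‖t₃‖ < 1) (h₄ : ‖t₄‖ < 1) :
    (1 - t₁ * t₂ * t₃ * t₄) * awIntegral (t₁ * q) t₂ t₃ t₄ q =
      (1 - t₁ * t₂) * (1 - t₁ * t₃) * (1 - t₁ * t₄) * awIntegral t₁ t₂ t₃ t₄ q := by
  have hw := continuous_awWeight_expI hq h₁ h₂ h₃ h₄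
  have hc : Continuous fun θ : ℝ => ((1 - t₁ * t₂ * t₃ * t₄) * (expI θ + (expI θ)⁻¹) -
      (t₁ + t₂ + t₃ + t₄) + (t₁ * t₂ * t₃ + t₁ * t₂ * t₄ + t₁ * t₃ * t₄ + t₂ * t₃ * t₄)) *
        awWeight t₁ t₂ t₃ t₄ q (expI θ) := by
    refine Continuous.mul ?_ hw
    have := continuous_expI
    have := continuous_expI_inv
    fun_prop
  have h := integral_awWeight_first_moment hq0 hq h₁ h₂ h₃ h₄
  have e : ∀ θ : ℝ, (1 - t₁ * t₂ * t₃ * t₄) * awWeight (t₁ * q) t₂ t₃ t₄ q (expI θ) =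
      (1 - t₁ * t₂) * (1 - t₁ * t₃) * (1 - t₁ * t₄) * awWeight t₁ t₂ t₃ t₄ q (expI θ) - t₁ *
      (((1 - t₁ * t₂ * t₃ * t₄) * (expI θ + (expI θ)⁻¹) -
      (t₁ + t₂ + t₃ + t₄) + (t₁ * t₂ * t₃ + t₁ * t₂ * t₄ + t₁ * t₃ * t₄ + t₂ * t₃ * t₄)) *
        awWeight t₁ t₂ t₃ t₄ q (expI θ)) := fun θ => by
    rw [awWeight_mul_q _ _ _ hq h₁ (norm_expI θ)]
    have hz0 := expI_ne_zero θ
    field_simp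
    ring
  rw [awIntegral, awIntegral, ← intervalIntegral.integral_const_mul,
    ← intervalIntegral.integral_const_mul]
  simp only [e]
  rw [intervalIntegral.integral_sub ((hw.const_mul _).intervalIntegrable _ _)
    ((hc.const_mul _).intervalIntegrable _ _), intervalIntegral.integral_const_mul t₁, h]
  ring

/-! ### Evaluation of the Askey–Wilson integral. -/

/-- The product `∏_{j < k} (t_j t_k; q)_∞`. -/
noncomputable def awPairs (t₁ t₂ t₃ t₄ q : ℂ) : ℂ :=
  qPochInf (t₁ * t₂) q * qPochInf (t₁ * t₃) q * qPochInf (t₁ * t₄) q * qPochInf (t₂ * t₃) q *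
    qPochInf (t₂ * t₄) q * qPochInf (t₃ * t₄) q

/-- The Askey–Wilson integral divided by the claimed dependence on the parameters. -/
noncomputable def awRatio (t₁ t₂ t₃ t₄ q : ℂ) : ℂ :=
  awIntegral t₁ t₂ t₃ t₄ q * awPairs t₁ t₂ t₃ t₄ q / qPochInf (t₁ * t₂ * t₃ * t₄) q

theorem awRatio_rotate (t₁ t₂ t₃ t₄ q : ℂ) :
    awRatio t₁ t₂ t₃ t₄ q = awRatio t₂ t₃ t₄ t₁ q := by
  simp only [awRatio, awIntegral, awWeight_rotate t₁ t₂ t₃ t₄]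
  rw [show t₁ * t₂ * t₃ * t₄ = t₂ * t₃ * t₄ * t₁ by ring, awPairs, awPairs, mul_comm t₁ t₂,
    mul_comm t₁ t₃, mul_comm t₁ t₄]
  ring

theorem norm_mul_four_lt_one {t₁ t₂ t₃ t₄ : ℂ}
    (h₁ : ‖t₁‖ < 1) (h₂ : ‖t₂‖ < 1) (h₃ : ‖t₃‖ < 1) (h₄ : ‖t₄‖ < 1) :
    ‖t₁ * t₂ * t₃ * t₄‖ < 1 :=
  norm_mul_lt_one (norm_mul_lt_one (norm_mul_lt_one h₁ h₂) h₃) h₄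

theorem awRatio_mul_q {q : ℂ} (hq0 : q ≠ 0) (hq : ‖q‖ < 1) {t₁ t₂ t₃ t₄ : ℂ}
    (h₁ : ‖t₁‖ < 1) (h₂ : ‖t₂‖ < 1) (h₃ : ‖t₃‖ < 1) (h₄ : ‖t₄‖ < 1) :
    awRatio (t₁ * q) t₂ t₃ t₄ q = awRatio t₁ t₂ t₃ t₄ q := by
  have h := awIntegral_mul_q hq0 hq h₁ h₂ h₃ h₄
  have hA := norm_mul_four_lt_one h₁ h₂ h₃ h₄
  have a1 := one_sub_ne_zero_of_norm_lt hA
  have a2 : qPochInf (t₁ * t₂ * t₃ * t₄ * q) q ≠ 0 :=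
    qPochInf_ne_zero (norm_mul_lt_one hA hq) hq
  rw [awRatio, awRatio, awPairs, awPairs, qPochInf_eq_mul (t₁ * t₂) hq, qPochInf_eq_mul (t₁ * t₃) hq,
    qPochInf_eq_mul (t₁ * t₄) hq, qPochInf_eq_mul (t₁ * t₂ * t₃ * t₄) hq,
    show t₁ * q * t₂ * t₃ * t₄ = t₁ * t₂ * t₃ * t₄ * q by ring, mul_right_comm t₁ q t₂,
    mul_right_comm t₁ q t₃, mul_right_comm t₁ q t₄,
    div_eq_div_iff a2 (mul_ne_zero a1 a2)]
  linear_combination (qPochInf (t₁ * t₂ * q) q * qPochInf (t₁ * t₃ * q) q *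
    qPochInf (t₁ * t₄ * q) q * qPochInf (t₂ * t₃) q * qPochInf (t₂ * t₄) q *
    qPochInf (t₃ * t₄) q * qPochInf (t₁ * t₂ * t₃ * t₄ * q) q) * h

theorem norm_mul_pow_lt_one {t q : ℂ} (ht : ‖t‖ < 1) (hq : ‖q‖ < 1) (k : ℕ) :
    ‖t * q ^ k‖ < 1 := by
  rw [norm_mul, norm_pow]
  exact mul_lt_one_of_nonneg_of_lt_one_left (norm_nonneg _) ht
    (pow_le_one₀ (norm_nonneg _) hq.le)

theorem continuous_awIntegral {Y : Type*} [TopologicalSpace Y] {q : ℂ} (hq : ‖q‖ < 1)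
    {t₁ t₂ t₃ t₄ : Y → ℂ} (c₁ : Continuous t₁) (c₂ : Continuous t₂) (c₃ : Continuous t₃)
    (c₄ : Continuous t₄) (h₁ : ∀ y, ‖t₁ y‖ < 1) (h₂ : ∀ y, ‖t₂ y‖ < 1)
    (h₃ : ∀ y, ‖t₃ y‖ < 1) (h₄ : ∀ y, ‖t₄ y‖ < 1) :
    Continuous fun y => awIntegral (t₁ y) (t₂ y) (t₃ y) (t₄ y) q := by
  refine intervalIntegral.continuous_parametric_intervalIntegral_of_continuous' ?_ _ _
  exact continuous_awWeight hq (c₁.comp continuous_fst) (c₂.comp continuous_fst)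
    (c₃.comp continuous_fst) (c₄.comp continuous_fst) (continuous_expI.comp continuous_snd)
    (fun y => h₁ _) (fun y => h₂ _) (fun y => h₃ _) (fun y => h₄ _) (fun y => norm_expI _)

theorem continuous_awRatio {Y : Type*} [TopologicalSpace Y] {q : ℂ} (hq : ‖q‖ < 1)
    {t₁ t₂ t₃ t₄ : Y → ℂ} (c₁ : Continuous t₁) (c₂ : Continuous t₂) (c₃ : Continuous t₃)
    (c₄ : Continuous t₄) (h₁ : ∀ y, ‖t₁ y‖ < 1) (h₂ : ∀ y, ‖t₂ y‖ < 1)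
    (h₃ : ∀ y, ‖t₃ y‖ < 1) (h₄ : ∀ y, ‖t₄ y‖ < 1) :
    Continuous fun y => awRatio (t₁ y) (t₂ y) (t₃ y) (t₄ y) q := by
  have hp := (differentiable_qPochInf hq).continuous
  unfold awRatio awPairs
  refine Continuous.div (Continuous.mul ?_ ?_) (hp.comp (by fun_prop)) fun y =>
    qPochInf_ne_zero (norm_mul_four_lt_one (h₁ y) (h₂ y) (h₃ y) (h₄ y)) hq
  · exact continuous_awIntegral hq c₁ c₂ c₃ c₄ h₁ h₂ h₃ h₄
  · have hc : ∀ f : Y → ℂ, Continuous f → Continuous fun y => qPochInf (f y) q :=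
      fun f hf => hp.comp hf
    exact (((((hc _ (by fun_prop)).mul (hc _ (by fun_prop))).mul (hc _ (by fun_prop))).mul
      (hc _ (by fun_prop))).mul (hc _ (by fun_prop))).mul (hc _ (by fun_prop))

-- Iterate the invariance under t₁ → t₁q and let t₁qᵏ → 0.
open Filter Topology in
theorem awRatio_eq_zero_left {q : ℂ} (hq0 : q ≠ 0) (hq : ‖q‖ < 1) {t₁ t₂ t₃ t₄ : ℂ}
    (h₁ : ‖t₁‖ < 1) (h₂ : ‖t₂‖ < 1) (h₃ : ‖t₃‖ < 1) (h₄ : ‖t₄‖ < 1) :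
    awRatio t₁ t₂ t₃ t₄ q = awRatio 0 t₂ t₃ t₄ q := by
  have hk : ∀ k : ℕ, awRatio (t₁ * q ^ k) t₂ t₃ t₄ q = awRatio t₁ t₂ t₃ t₄ q := fun k => by
    induction k with
    | zero => simp
    | succ k ih =>
      rw [pow_succ, ← mul_assoc, awRatio_mul_q hq0 hq (norm_mul_pow_lt_one h₁ hq k) h₂ h₃ h₄, ih]
  have hc : Continuous fun y : Metric.ball (0 : ℂ) 1 => awRatio y t₂ t₃ t₄ q :=
    continuous_awRatio hq continuous_subtype_val continuous_const continuous_const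
      continuous_const (fun y => mem_ball_zero_iff.mp y.2) (fun _ => h₂) (fun _ => h₃) (fun _ => h₄)
  have hlim : Tendsto (fun k : ℕ => (⟨t₁ * q ^ k,
      mem_ball_zero_iff.mpr (norm_mul_pow_lt_one h₁ hq k)⟩ : Metric.ball (0 : ℂ) 1)) atTop (𝓝 ⟨0, by simp⟩) := by
    rw [tendsto_subtype_rng]
    simpa using (tendsto_pow_atTop_nhds_zero_of_norm_lt_one hq).const_mul t₁
  have := (hc.tendsto _).comp hlim
  simp only [Function.comp_def, hk] at this
  exact tendsto_nhds_unique tendsto_const_nhds this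

theorem awRatio_eq_zero {q : ℂ} (hq0 : q ≠ 0) (hq : ‖q‖ < 1) {t₁ t₂ t₃ t₄ : ℂ}
    (h₁ : ‖t₁‖ < 1) (h₂ : ‖t₂‖ < 1) (h₃ : ‖t₃‖ < 1) (h₄ : ‖t₄‖ < 1) :
    awRatio t₁ t₂ t₃ t₄ q = awRatio 0 0 0 0 q := by
  have h0 : ‖(0 : ℂ)‖ < 1 := by simp
  rw [awRatio_eq_zero_left hq0 hq h₁ h₂ h₃ h₄, awRatio_rotate,
    awRatio_eq_zero_left hq0 hq h₂ h₃ h₄ h0, awRatio_rotate,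
    awRatio_eq_zero_left hq0 hq h₃ h₄ h0 h0, awRatio_rotate,
    awRatio_eq_zero_left hq0 hq h₄ h0 h0 h0]

/-- For these parameters the denominator factors multiply to (qz²; q)_∞ (qz⁻²; q)_∞, since (q²z²;
q²)_∞ (qz²; q²)_∞ = (qz²; q)_∞. Only an elementary weight is left. -/
theorem awWeight_special {q r z : ℂ} (hq : ‖q‖ < 1) (hr : r ^ 2 = q) (hz : ‖z‖ = 1) :
    awWeight q (-q) r (-r) q z = (1 - z ^ 2) * (1 - z⁻¹ ^ 2) := by
  have hr1 : ‖r‖ < 1 := by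
    have : ‖r‖ ^ 2 < 1 := by rw [← norm_pow, hr]; exact hq
    exact (sq_lt_one_iff₀ (norm_nonneg _)).mp this
  have key : ∀ z : ℂ, qPochInf (q * z ^ 2) q = qPochInf (q * z) q * qPochInf (-q * z) q *
      (qPochInf (r * z) q * qPochInf (-r * z) q) := fun z => by
    rw [neg_mul, neg_mul, qPochInf_mul_neg _ hq, qPochInf_mul_neg _ hq,
      ← qPochInf_even_mul_odd (q * z ^ 2) hq, mul_pow r, hr]
    ring_nf
  have hne : ∀ t : ℂ, ‖t‖ < 1 → ∀ w : ℂ, ‖w‖ = 1 → qPochInf (t * w) q ≠ 0 := fun t ht w hw =>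
    qPochInf_ne_zero (norm_mul_circle_lt ht hw) hq
  have hzi := norm_inv_circle hz
  have hq' : ‖-q‖ < 1 := by rwa [norm_neg]
  have hr' : ‖-r‖ < 1 := by rwa [norm_neg]
  rw [awWeight_eq_reduced hq, awReducedWeight, key, key, div_eq_one_iff_eq _ |>.mpr, mul_one]
  · ring
  · have := hne q hq z hz
    have := hne _ hq' z hz
    have := hne r hr1 z hz
    have := hne _ hr' z hz
    have := hne q hq _ hzi
    have := hne _ hq' _ hzi
    have := hne r hr1 _ hzi
    have := hne _ hr' _ hzi
    simp only [ne_eq, mul_eq_zero, not_or]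
    tauto

theorem integral_one_sub_sq_mul : ∫ θ in (0 : ℝ)..Real.pi,
    (1 - expI θ ^ 2) * (1 - (expI θ)⁻¹ ^ 2) = 2 * (Real.pi : ℂ) := by
  have e : ∀ θ : ℝ, (1 - expI θ ^ 2) * (1 - (expI θ)⁻¹ ^ 2) =
      ((2 - 2 * Real.cos (2 * θ) : ℝ) : ℂ) := fun θ => by
    have hz := expI_ne_zero θ
    have h1 : (1 - expI θ ^ 2) * (1 - (expI θ)⁻¹ ^ 2) =
        2 - (expI θ ^ 2 + (expI θ)⁻¹ ^ 2) := by field_simp; ring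
    have h2 : expI θ ^ 2 + (expI θ)⁻¹ ^ 2 = 2 * Complex.cos (2 * θ) := by
      rw [← expNegI_eq_inv, expI, expNegI, ← Complex.exp_nat_mul, ← Complex.exp_nat_mul,
        Complex.two_cos]
      push_cast
      ring_nf
    rw [h1, h2]; push_cast; ring
  simp only [e]
  rw [intervalIntegral.integral_ofReal]
  have : ∫ θ in (0 : ℝ)..Real.pi, (2 - 2 * Real.cos (2 * θ)) = 2 * Real.pi := by
    rw [intervalIntegral.integral_sub (by simp)
      (Continuous.intervalIntegrable (by fun_prop) _ _), intervalIntegral.integral_const_mul,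
      intervalIntegral.integral_comp_mul_left (fun x => Real.cos x) two_ne_zero]
    simp only [intervalIntegral.integral_const, mul_zero, integral_cos, Real.sin_two_pi,
      Real.sin_zero, sub_self, sub_zero, smul_eq_mul]
    ring
  rw [this]; push_cast; rfl

theorem awRatio_special {q r : ℂ} (hq : ‖q‖ < 1) (hr : r ^ 2 = q) :
    awRatio q (-q) r (-r) q = 2 * Real.pi / qPochInf q q := by
  have hI : awIntegral q (-q) r (-r) q = 2 * Real.pi := by
    simp only [awIntegral, awWeight_special hq hr (norm_expI _)]
    exact integral_one_sub_sq_mul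
  have hq3 : ‖q * q * q‖ < 1 := norm_mul_lt_one (norm_mul_lt_one hq hq) hq
  have n3 := qPochInf_ne_zero hq3 hq
  have n1 := qPochInf_ne_zero hq hq
  have s1 : qPochInf q q = (1 - q) * ((1 - q * q) * qPochInf (q * q * q) q) := by
    rw [qPochInf_eq_mul q hq, qPochInf_eq_mul (q * q) hq]
  have s2 : qPochInf (-q) q = (1 + q) * qPochInf (-q * q) q := by
    rw [qPochInf_eq_mul (-q) hq]; ring
  have s3 : qPochInf q (q ^ 2) = (1 - q) * qPochInf (q * q ^ 2) (q ^ 2) :=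
    qPochInf_eq_mul q (norm_sq_lt_one hq)
  have s4 : qPochInf (q * r) q * qPochInf (-(q * r)) q = qPochInf (q * q ^ 2) (q ^ 2) := by
    rw [qPochInf_mul_neg _ hq, mul_pow, hr]; ring_nf
  have eu := qPochInf_neg_mul_qPochInf_sq hq
  have hq1 := one_sub_ne_zero_of_norm_lt hq
  have hq2 : 1 + q ≠ 0 := by
    have := one_sub_ne_zero_of_norm_lt (a := -q) (by rwa [norm_neg])
    simpa using this
  -- The pairwise products are -q², -q, and ±q√q twice each. Euler's identity is used twice, once
  -- for (-q; q)_∞ and once for (-q²; q)_∞.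
  have hP : awPairs q (-q) r (-r) q * qPochInf q q = qPochInf (q * q * q) q := by
    have e : awPairs q (-q) r (-r) q = qPochInf (-q * q) q * qPochInf (-q) q *
        (qPochInf (q * r) q * qPochInf (-(q * r)) q) ^ 2 := by
      rw [awPairs, show r * -r = -q by rw [← hr]; ring, mul_comm q (-q), mul_neg q r, neg_mul q r,
        neg_mul_neg q r]
      ring
    rw [e, s4, s1]
    have e1 : (1 + q) * qPochInf (-q * q) q * ((1 - q) * qPochInf (q * q ^ 2) (q ^ 2)) = 1 := by
      rw [← s2, ← s3, eu]
    have e2 : qPochInf (-q) q * ((1 - q) * qPochInf (q * q ^ 2) (q ^ 2)) = 1 := by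
      rw [← s3, eu]
    linear_combination qPochInf (q * q * q) q * e2 + qPochInf (q * q * q) q *
      (qPochInf (-q) q * ((1 - q) * qPochInf (q * q ^ 2) (q ^ 2))) * e1
  rw [awRatio, hI, show q * -q * r * -r = q * q * q by rw [← hr]; ring, div_eq_div_iff n3 n1]
  linear_combination 2 * (Real.pi : ℂ) * hP

theorem awPairs_ne_zero {q : ℂ} (hq : ‖q‖ < 1) {t₁ t₂ t₃ t₄ : ℂ}
    (h₁ : ‖t₁‖ < 1) (h₂ : ‖t₂‖ < 1) (h₃ : ‖t₃‖ < 1) (h₄ : ‖t₄‖ < 1) :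
    awPairs t₁ t₂ t₃ t₄ q ≠ 0 := by
  have hne : ∀ a b : ℂ, ‖a‖ < 1 → ‖b‖ < 1 → qPochInf (a * b) q ≠ 0 := fun a b ha hb =>
    qPochInf_ne_zero (norm_mul_lt_one ha hb) hq
  have := hne _ _ h₁ h₂
  have := hne _ _ h₁ h₃
  have := hne _ _ h₁ h₄
  have := hne _ _ h₂ h₃
  have := hne _ _ h₂ h₄
  have := hne _ _ h₃ h₄
  simp only [awPairs, ne_eq, mul_eq_zero, not_or]
  tauto

theorem askeyWilsonMass_eq (t₁ t₂ t₃ t₄ q : ℂ) : askeyWilsonMass t₁ t₂ t₃ t₄ q =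
    2 * Real.pi * qPochInf (t₁ * t₂ * t₃ * t₄) q / (qPochInf q q * awPairs t₁ t₂ t₃ t₄ q) := by
  simp [askeyWilsonMass, qPochsInf, awPairs, mul_assoc]

/-- The Askey–Wilson integral. -/
theorem awIntegral_eq_mass {q : ℂ} (hq0 : q ≠ 0) (hq : ‖q‖ < 1) {t₁ t₂ t₃ t₄ : ℂ}
    (h₁ : ‖t₁‖ < 1) (h₂ : ‖t₂‖ < 1) (h₃ : ‖t₃‖ < 1) (h₄ : ‖t₄‖ < 1) :
    awIntegral t₁ t₂ t₃ t₄ q = askeyWilsonMass t₁ t₂ t₃ t₄ q := by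
  obtain ⟨r, hr⟩ : ∃ r : ℂ, r ^ 2 = q := IsAlgClosed.exists_pow_nat_eq q two_pos
  have hr1 : ‖r‖ < 1 := by
    have : ‖r‖ ^ 2 < 1 := by rw [← norm_pow, hr]; exact hq
    exact (sq_lt_one_iff₀ (norm_nonneg _)).mp this
  have h := awRatio_special hq hr
  rw [awRatio_eq_zero hq0 hq hq (by rwa [norm_neg]) hr1 (by rwa [norm_neg]),
    ← awRatio_eq_zero hq0 hq h₁ h₂ h₃ h₄, awRatio] at h
  have n1 := qPochInf_ne_zero hq hq
  have nA := qPochInf_ne_zero (norm_mul_four_lt_one h₁ h₂ h₃ h₄) hq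
  have nP := awPairs_ne_zero hq h₁ h₂ h₃ h₄
  rw [div_eq_div_iff nA n1] at h
  rw [askeyWilsonMass_eq, eq_div_iff (mul_ne_zero n1 nP)]
  linear_combination h

/-! ### Moments and orthogonality of the polynomials. -/

theorem askeyWilsonMass_shift {q : ℂ} (hq : ‖q‖ < 1) {t₁ t₂ t₃ t₄ : ℂ}
    (h₁ : ‖t₁‖ < 1) (h₂ : ‖t₂‖ < 1) (h₃ : ‖t₃‖ < 1) (h₄ : ‖t₄‖ < 1) (k j : ℕ) :
    askeyWilsonMass (t₁ * q ^ k) (t₂ * q ^ j) t₃ t₄ q =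
      askeyWilsonMass t₁ t₂ t₃ t₄ q * awMoment t₁ t₂ t₃ t₄ q k j := by
  have hs : ∀ a (n : ℕ), qPochInf a q = qPoch a q n * qPochInf (a * q ^ n) q := fun a n =>
    qPochInf_eq_qPoch_mul a hq n
  have a1 := qPoch_ne_zero (norm_mul_lt_one h₁ h₂) hq (k + j)
  have a2 := qPoch_ne_zero (norm_mul_lt_one h₁ h₃) hq k
  have a3 := qPoch_ne_zero (norm_mul_lt_one h₁ h₄) hq k
  have a4 := qPoch_ne_zero (norm_mul_lt_one h₂ h₃) hq j
  have a5 := qPoch_ne_zero (norm_mul_lt_one h₂ h₄) hq j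
  have a6 := qPoch_ne_zero (norm_mul_four_lt_one h₁ h₂ h₃ h₄) hq (k + j)
  rw [askeyWilsonMass_eq, askeyWilsonMass_eq, awMoment, awPairs, awPairs, hs (t₁ * t₂) (k + j),
    hs (t₁ * t₃) k, hs (t₁ * t₄) k, hs (t₂ * t₃) j, hs (t₂ * t₄) j,
    hs (t₁ * t₂ * t₃ * t₄) (k + j), pow_add]
  rw [show t₁ * q ^ k * (t₂ * q ^ j) * t₃ * t₄ = t₁ * t₂ * t₃ * t₄ * (q ^ k * q ^ j) by ring,
    show t₁ * q ^ k * (t₂ * q ^ j) = t₁ * t₂ * (q ^ k * q ^ j) by ring,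
    mul_right_comm t₁ (q ^ k) t₃, mul_right_comm t₁ (q ^ k) t₄, mul_right_comm t₂ (q ^ j) t₃,
    mul_right_comm t₂ (q ^ j) t₄]
  have alg : ∀ P E A x₁ x₂ x₃ x₄ x₅ x₆ b₁ b₂ b₃ b₄ b₅ b₆ : ℂ, b₁ ≠ 0 → b₂ ≠ 0 → b₃ ≠ 0 → b₄ ≠ 0 →
      b₅ ≠ 0 → b₆ ≠ 0 → P * A / (E * (x₁ * x₂ * x₃ * x₄ * x₅ * x₆)) =
      P * (b₆ * A) / (E * (b₁ * x₁ * (b₂ * x₂) * (b₃ * x₃) * (b₄ * x₄) * (b₅ * x₅) * x₆)) *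
        (b₁ * (b₂ * b₃) * (b₄ * b₅) / b₆) := by
    intro P E A x₁ x₂ x₃ x₄ x₅ x₆ b₁ b₂ b₃ b₄ b₅ b₆ n₁ n₂ n₃ n₄ n₅ n₆
    have hb : b₁ * (b₂ * b₃) * (b₄ * b₅) * b₆ ≠ 0 :=
      mul_ne_zero (mul_ne_zero (mul_ne_zero n₁ (mul_ne_zero n₂ n₃)) (mul_ne_zero n₄ n₅)) n₆
    rw [← mul_div_mul_left _ _ hb, div_mul_div_comm]
    congr 1 <;> ring
  exact alg _ _ _ _ _ _ _ _ _ _ _ _ _ _ _ a1 a2 a3 a4 a5 a6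

theorem integral_qPoch_mul_awWeight {q : ℂ} (hq0 : q ≠ 0) (hq : ‖q‖ < 1) {t₁ t₂ t₃ t₄ : ℂ}
    (h₁ : ‖t₁‖ < 1) (h₂ : ‖t₂‖ < 1) (h₃ : ‖t₃‖ < 1) (h₄ : ‖t₄‖ < 1) (k j : ℕ) :
    ∫ θ in (0 : ℝ)..Real.pi, qPoch (t₁ * expI θ) q k * qPoch (t₁ * (expI θ)⁻¹) q k *
      (qPoch (t₂ * expI θ) q j * qPoch (t₂ * (expI θ)⁻¹) q j) *
        awWeight t₁ t₂ t₃ t₄ q (expI θ) =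
      askeyWilsonMass t₁ t₂ t₃ t₄ q * awMoment t₁ t₂ t₃ t₄ q k j := by
  rw [← askeyWilsonMass_shift hq h₁ h₂ h₃ h₄, ← awIntegral_eq_mass hq0 hq
    (norm_mul_pow_lt_one h₁ hq k) (norm_mul_pow_lt_one h₂ hq j) h₃ h₄, awIntegral]
  refine intervalIntegral.integral_congr fun θ _ => ?_
  have hz := norm_expI θ
  rw [awWeight_mul_q_pow _ _ _ hq h₁ hz, awWeight_rotate t₁ (t₂ * q ^ j),
    awWeight_mul_q_pow _ _ _ hq h₂ hz, ← awWeight_rotate t₁ t₂]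
  ring

/-- This symmetry, plain in the generating function, is what allows expansion in the t₂-basis as
well. -/
theorem iwPoly_swap (t₁ t₂ t₃ t₄ q z : ℂ) (n : ℕ) :
    iwPoly t₁ t₂ t₃ t₄ q z n = iwPoly t₂ t₁ t₃ t₄ q z n := by
  simp only [iwPoly, twoPhiOneCoeff, mul_comm (qPoch (t₁ * z) q _), mul_comm t₁ t₂]

theorem continuous_qPoch {Y : Type*} [TopologicalSpace Y] {f : Y → ℂ} (hf : Continuous f)
    (q : ℂ) (n : ℕ) : Continuous fun y => qPoch (f y) q n := by
  unfold qPoch; fun_prop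

theorem continuous_twoPhiOneCoeff {Y : Type*} [TopologicalSpace Y] {q : ℂ} (hq : ‖q‖ < 1)
    {a b c : Y → ℂ} (ha : Continuous a) (hb : Continuous b) (hc : Continuous c)
    (hc1 : ∀ y, ‖c y‖ < 1) (n : ℕ) :
    Continuous fun y => twoPhiOneCoeff (a y) (b y) (c y) q n := by
  unfold twoPhiOneCoeff
  exact ((continuous_qPoch ha q n).mul (continuous_qPoch hb q n)).div
    (continuous_const.mul (continuous_qPoch hc q n)) fun y =>
      mul_ne_zero (qPoch_ne_zero hq hq n) (qPoch_ne_zero (hc1 y) hq n)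

theorem continuous_iwPoly {Y : Type*} [TopologicalSpace Y] {q : ℂ} (hq : ‖q‖ < 1)
    {t₁ t₂ t₃ t₄ z : Y → ℂ} (c₁ : Continuous t₁) (c₂ : Continuous t₂) (c₃ : Continuous t₃)
    (c₄ : Continuous t₄) (cz : Continuous z) (h₁ : ∀ y, ‖t₁ y‖ < 1) (h₂ : ∀ y, ‖t₂ y‖ < 1)
    (h₃ : ∀ y, ‖t₃ y‖ < 1) (h₄ : ∀ y, ‖t₄ y‖ < 1) (hz : ∀ y, ‖z y‖ = 1) (n : ℕ) :
    Continuous fun y => iwPoly (t₁ y) (t₂ y) (t₃ y) (t₄ y) q (z y) n := by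
  have czi : Continuous fun y => (z y)⁻¹ := cz.inv₀ fun y h => by simpa [h] using hz y
  unfold iwPoly
  refine continuous_finsetSum _ fun p _ => ?_
  exact ((continuous_twoPhiOneCoeff hq (c₁.mul cz) (c₂.mul cz) (c₁.mul c₂)
    (fun y => norm_mul_lt_one (h₁ y) (h₂ y)) _).mul (czi.pow _)).mul
    ((continuous_twoPhiOneCoeff hq (c₃.mul czi) (c₄.mul czi) (c₃.mul c₄)
    (fun y => norm_mul_lt_one (h₃ y) (h₄ y)) _).mul (cz.pow _))

/-- The integral of `iwPoly n * iwPoly m` against the Askey–Wilson weight. -/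
noncomputable def iwInner (t₁ t₂ t₃ t₄ q : ℂ) (n m : ℕ) : ℂ :=
  ∫ θ in (0 : ℝ)..Real.pi, iwPoly t₁ t₂ t₃ t₄ q (expI θ) n * iwPoly t₁ t₂ t₃ t₄ q (expI θ) m *
    awWeight t₁ t₂ t₃ t₄ q (expI θ)

open Finset in
theorem iwInner_of_ne_zero {q : ℂ} (hq0 : q ≠ 0) (hq : ‖q‖ < 1) {t₁ t₂ t₃ t₄ : ℂ}
    (h₁ : ‖t₁‖ < 1) (h₂ : ‖t₂‖ < 1) (h₃ : ‖t₃‖ < 1) (h₄ : ‖t₄‖ < 1)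
    (n₁ : t₁ ≠ 0) (n₂ : t₂ ≠ 0) (n₃ : t₃ ≠ 0) (n₄ : t₄ ≠ 0) {n m : ℕ} (hmn : m ≤ n) :
    iwInner t₁ t₂ t₃ t₄ q n m =
      askeyWilsonMass t₁ t₂ t₃ t₄ q * if m = n then awNorm t₁ t₂ t₃ t₄ q n else 0 := by
  rw [← sum_sum_awCoeff_mul_awMoment hq hq0 h₁ h₂ h₃ h₄ n₁ n₂ n₃ n₄ hmn, mul_sum, iwInner]
  have hint : ∀ k j : ℕ, IntervalIntegrable (fun θ : ℝ =>
      qPoch (t₁ * expI θ) q k * qPoch (t₁ * (expI θ)⁻¹) q k *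
      (qPoch (t₂ * expI θ) q j * qPoch (t₂ * (expI θ)⁻¹) q j) *
        awWeight t₁ t₂ t₃ t₄ q (expI θ)) MeasureTheory.volume 0 Real.pi := fun k j => by
    have c := continuous_expI
    have c' := continuous_expI_inv
    refine Continuous.intervalIntegrable ?_ _ _
    exact (((continuous_qPoch (continuous_const.mul c) q k).mul
      (continuous_qPoch (continuous_const.mul c') q k)).mul
      ((continuous_qPoch (continuous_const.mul c) q j).mul
      (continuous_qPoch (continuous_const.mul c') q j))).mul
      (continuous_awWeight_expI hq h₁ h₂ h₃ h₄)
  have e : ∀ θ : ℝ, iwPoly t₁ t₂ t₃ t₄ q (expI θ) n * iwPoly t₁ t₂ t₃ t₄ q (expI θ) m *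
      awWeight t₁ t₂ t₃ t₄ q (expI θ) = ∑ p ∈ antidiagonal n, ∑ r ∈ antidiagonal m,
        awCoeff t₁ t₂ t₃ t₄ q n p.1 * awCoeff t₂ t₁ t₃ t₄ q m r.1 *
        (qPoch (t₁ * expI θ) q p.1 * qPoch (t₁ * (expI θ)⁻¹) q p.1 *
      (qPoch (t₂ * expI θ) q r.1 * qPoch (t₂ * (expI θ)⁻¹) q r.1) *
        awWeight t₁ t₂ t₃ t₄ q (expI θ)) := fun θ => by
    have hz := norm_expI θ
    rw [iwPoly_eq_sum hq hq0 h₁ h₂ h₃ h₄ n₁ n₃ n₄ hz, iwPoly_swap,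
      iwPoly_eq_sum hq hq0 h₂ h₁ h₃ h₄ n₂ n₃ n₄ hz, sum_mul_sum, sum_mul]
    refine sum_congr rfl fun p _ => ?_
    rw [sum_mul]
    exact sum_congr rfl fun r _ => by ring
  simp only [e]
  rw [intervalIntegral.integral_finsetSum fun p _ => by
    simpa only [sum_fn] using IntervalIntegrable.sum (antidiagonal m) fun r _ =>
      (hint p.1 r.1).const_mul (awCoeff t₁ t₂ t₃ t₄ q n p.1 * awCoeff t₂ t₁ t₃ t₄ q m r.1)]
  refine sum_congr rfl fun p _ => ?_
  rw [intervalIntegral.integral_finsetSum fun r _ => (hint p.1 r.1).const_mul _, mul_sum]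
  refine sum_congr rfl fun r _ => ?_
  rw [intervalIntegral.integral_const_mul, integral_qPoch_mul_awWeight hq0 hq h₁ h₂ h₃ h₄]
  ring

theorem continuous_iwInner {Y : Type*} [TopologicalSpace Y] {q : ℂ} (hq : ‖q‖ < 1)
    {t₁ t₂ t₃ t₄ : Y → ℂ} (c₁ : Continuous t₁) (c₂ : Continuous t₂) (c₃ : Continuous t₃)
    (c₄ : Continuous t₄) (h₁ : ∀ y, ‖t₁ y‖ < 1) (h₂ : ∀ y, ‖t₂ y‖ < 1)
    (h₃ : ∀ y, ‖t₃ y‖ < 1) (h₄ : ∀ y, ‖t₄ y‖ < 1) (n m : ℕ) :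
    Continuous fun y => iwInner (t₁ y) (t₂ y) (t₃ y) (t₄ y) q n m := by
  refine intervalIntegral.continuous_parametric_intervalIntegral_of_continuous' ?_ _ _
  have hP := fun n => continuous_iwPoly hq (c₁.comp (continuous_fst (Y := ℝ)))
    (c₂.comp continuous_fst) (c₃.comp continuous_fst) (c₄.comp continuous_fst)
    (continuous_expI.comp continuous_snd) (fun y => h₁ _) (fun y => h₂ _) (fun y => h₃ _)
    (fun y => h₄ _) (fun y => norm_expI _) n
  exact ((hP n).mul (hP m)).mul (continuous_awWeight hq (c₁.comp continuous_fst)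
    (c₂.comp continuous_fst) (c₃.comp continuous_fst) (c₄.comp continuous_fst)
    (continuous_expI.comp continuous_snd) (fun y => h₁ _) (fun y => h₂ _) (fun y => h₃ _)
    (fun y => h₄ _) (fun y => norm_expI _))

theorem continuous_awNorm {Y : Type*} [TopologicalSpace Y] {q : ℂ} (hq : ‖q‖ < 1)
    {t₁ t₂ t₃ t₄ : Y → ℂ} (c₁ : Continuous t₁) (c₂ : Continuous t₂) (c₃ : Continuous t₃)
    (c₄ : Continuous t₄) (h₁ : ∀ y, ‖t₁ y‖ < 1) (h₂ : ∀ y, ‖t₂ y‖ < 1)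
    (h₃ : ∀ y, ‖t₃ y‖ < 1) (h₄ : ∀ y, ‖t₄ y‖ < 1) (n : ℕ) :
    Continuous fun y => awNorm (t₁ y) (t₂ y) (t₃ y) (t₄ y) q n := by
  unfold awNorm
  have cA : Continuous fun y => t₁ y * t₂ y * t₃ y * t₄ y := ((c₁.mul c₂).mul c₃).mul c₄
  have c := fun {f : Y → ℂ} (hf : Continuous f) n => continuous_qPoch hf q n
  refine Continuous.div (((((c (c₁.mul c₃) n).mul (c (c₁.mul c₄) n)).mul (c (c₂.mul c₃) n)).mul
    (c (c₂.mul c₄) n)).mul (c ((cA.mul continuous_const).mul continuous_const) n))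
    ((((c cA _).mul (c (c₃.mul c₄) n)).mul continuous_const).mul (c (c₁.mul c₂) n)) fun y => ?_
  exact mul_ne_zero (mul_ne_zero (mul_ne_zero
    (qPoch_ne_zero (norm_mul_four_lt_one (h₁ y) (h₂ y) (h₃ y) (h₄ y)) hq _)
    (qPoch_ne_zero (norm_mul_lt_one (h₃ y) (h₄ y)) hq _)) (qPoch_ne_zero hq hq _))
    (qPoch_ne_zero (norm_mul_lt_one (h₁ y) (h₂ y)) hq _)

-- Vanishing parameters, excluded by Sears' transformation, are reached by continuity. All four
-- parameters are shifted by the same small s, and for s ≠ 0 near 0 none of them vanishes.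
open Filter Topology in
theorem iwInner_of_le {q : ℂ} (hq0 : q ≠ 0) (hq : ‖q‖ < 1) {t₁ t₂ t₃ t₄ : ℂ}
    (h₁ : ‖t₁‖ < 1) (h₂ : ‖t₂‖ < 1) (h₃ : ‖t₃‖ < 1) (h₄ : ‖t₄‖ < 1) {n m : ℕ} (hmn : m ≤ n) :
    iwInner t₁ t₂ t₃ t₄ q n m =
      askeyWilsonMass t₁ t₂ t₃ t₄ q * if m = n then awNorm t₁ t₂ t₃ t₄ q n else 0 := by
  have hev : ∀ t : ℂ, ‖t‖ < 1 → ∀ᶠ s in 𝓝 (0 : ℂ), ‖t + s‖ < 1 := fun t ht => by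
    have : ContinuousAt (fun s : ℂ => ‖t + s‖) 0 := by fun_prop
    exact this.eventually_lt_const (by simpa using ht)
  have hne : ∀ t : ℂ, ∀ᶠ s in 𝓝[≠] (0 : ℂ), t + s ≠ 0 := fun t => by
    by_cases ht : t = 0
    · subst ht
      filter_upwards [self_mem_nhdsWithin] with s hs using by simpa using hs
    · have : ContinuousAt (fun s : ℂ => t + s) 0 := by fun_prop
      exact (this.eventually_ne (by simpa using ht)).filter_mono nhdsWithin_le_nhds
  let Y := {s : ℂ // ‖t₁ + s‖ < 1 ∧ ‖t₂ + s‖ < 1 ∧ ‖t₃ + s‖ < 1 ∧ ‖t₄ + s‖ < 1}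
  let y₀ : Y := ⟨0, by simpa using ⟨h₁, h₂, h₃, h₄⟩⟩
  have hY : ∀ᶠ s in 𝓝[≠] (0 : ℂ),
      ‖t₁ + s‖ < 1 ∧ ‖t₂ + s‖ < 1 ∧ ‖t₃ + s‖ < 1 ∧ ‖t₄ + s‖ < 1 :=
    ((hev _ h₁).and ((hev _ h₂).and ((hev _ h₃).and (hev _ h₄)))).filter_mono nhdsWithin_le_nhds
  have ct : ∀ t : ℂ, Continuous fun y : Y => t + y.1 := fun t =>
    continuous_const.add continuous_subtype_val
  have cl := continuous_iwInner hq (ct t₁) (ct t₂) (ct t₃) (ct t₄) (fun y => y.2.1)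
    (fun y => y.2.2.1) (fun y => y.2.2.2.1) (fun y => y.2.2.2.2) n m
  -- The mass is replaced by the integral equal to it, whose continuity is already known.
  have cm := continuous_awIntegral hq (ct t₁) (ct t₂) (ct t₃) (ct t₄) (fun y => y.2.1)
    (fun y => y.2.2.1) (fun y => y.2.2.2.1) (fun y => y.2.2.2.2)
  have cn := continuous_awNorm hq (ct t₁) (ct t₂) (ct t₃) (ct t₄) (fun y => y.2.1)
    (fun y => y.2.2.1) (fun y => y.2.2.2.1) (fun y => y.2.2.2.2) n
  have cr : Continuous fun y : Y => awIntegral (t₁ + y.1) (t₂ + y.1) (t₃ + y.1) (t₄ + y.1) q *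
      if m = n then awNorm (t₁ + y.1) (t₂ + y.1) (t₃ + y.1) (t₄ + y.1) q n else 0 := by
    split_ifs
    · exact cm.mul cn
    · exact cm.mul continuous_const
  have hclosed := isClosed_eq cl cr
  have hfreq : y₀ ∈ closure {y : Y | y.1 ≠ 0 ∧ t₁ + y.1 ≠ 0 ∧ t₂ + y.1 ≠ 0 ∧ t₃ + y.1 ≠ 0 ∧
      t₄ + y.1 ≠ 0} := by
    rw [closure_subtype, mem_closure_iff_frequently]
    have h := (hY.and ((eventually_mem_nhdsWithin (s := {0}ᶜ) (a := (0 : ℂ))).and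
      ((hne t₁).and ((hne t₂).and ((hne t₃).and (hne t₄)))))).frequently
    refine (h.filter_mono nhdsWithin_le_nhds).mono fun s hs => ?_
    exact ⟨⟨s, hs.1⟩, hs.2, rfl⟩
  have hsub : {y : Y | y.1 ≠ 0 ∧ t₁ + y.1 ≠ 0 ∧ t₂ + y.1 ≠ 0 ∧ t₃ + y.1 ≠ 0 ∧ t₄ + y.1 ≠ 0} ⊆
      {y : Y | iwInner (t₁ + y.1) (t₂ + y.1) (t₃ + y.1) (t₄ + y.1) q n m =
        awIntegral (t₁ + y.1) (t₂ + y.1) (t₃ + y.1) (t₄ + y.1) q *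
      if m = n then awNorm (t₁ + y.1) (t₂ + y.1) (t₃ + y.1) (t₄ + y.1) q n else 0} := by
    rintro y ⟨-, m₁, m₂, m₃, m₄⟩
    obtain ⟨k₁, k₂, k₃, k₄⟩ := y.2
    change _ = _
    rw [iwInner_of_ne_zero hq0 hq k₁ k₂ k₃ k₄ m₁ m₂ m₃ m₄ hmn,
      awIntegral_eq_mass hq0 hq k₁ k₂ k₃ k₄]
  have := closure_minimal hsub hclosed hfreq
  simp only [Set.mem_ofPred_eq, y₀, add_zero] at this
  rw [this, awIntegral_eq_mass hq0 hq h₁ h₂ h₃ h₄]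

/-- Orthogonality of the polynomials `iwPoly`. -/
theorem iwInner_eq {q : ℂ} (hq0 : q ≠ 0) (hq : ‖q‖ < 1) {t₁ t₂ t₃ t₄ : ℂ}
    (h₁ : ‖t₁‖ < 1) (h₂ : ‖t₂‖ < 1) (h₃ : ‖t₃‖ < 1) (h₄ : ‖t₄‖ < 1) (n m : ℕ) :
    iwInner t₁ t₂ t₃ t₄ q n m =
      if n = m then askeyWilsonMass t₁ t₂ t₃ t₄ q * awNorm t₁ t₂ t₃ t₄ q n else 0 := by
  rcases le_total m n with h | h
  · rw [iwInner_of_le hq0 hq h₁ h₂ h₃ h₄ h, mul_ite, mul_zero]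
    simp only [eq_comm]
  · have : iwInner t₁ t₂ t₃ t₄ q n m = iwInner t₁ t₂ t₃ t₄ q m n := by
      simp only [iwInner, mul_comm (iwPoly t₁ t₂ t₃ t₄ q _ n)]
    rw [this, iwInner_of_le hq0 hq h₁ h₂ h₃ h₄ h, mul_ite, mul_zero]
    split_ifs with hnm
    · rw [hnm]
    · rfl

/-! ### Uniform bounds, the generating function and termwise integration. -/

/-- From |1 - aqᵏ| ≤ 1 + |q|ᵏ ≤ exp(|q|ᵏ). The bound is uniform in a, as needed when a = t_j e^{±iθ}
moves with θ. -/
theorem norm_qPoch_le {a q : ℂ} (ha : ‖a‖ ≤ 1) (hq : ‖q‖ < 1) (n : ℕ) :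
    ‖qPoch a q n‖ ≤ Real.exp (∑' k : ℕ, ‖q‖ ^ k) := by
  have hs := summable_geometric_of_lt_one (norm_nonneg q) hq
  calc ‖qPoch a q n‖ = ∏ k ∈ Finset.range n, ‖1 - a * q ^ k‖ := by rw [qPoch, norm_prod]
    _ ≤ ∏ k ∈ Finset.range n, Real.exp (‖q‖ ^ k) := by
      refine Finset.prod_le_prod (fun _ _ => norm_nonneg _) fun k _ => ?_
      calc ‖1 - a * q ^ k‖ ≤ ‖(1 : ℂ)‖ + ‖a * q ^ k‖ := norm_sub_le _ _
        _ ≤ ‖q‖ ^ k + 1 := by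
          rw [norm_one, norm_mul, norm_pow, add_comm]
          gcongr
          exact mul_le_of_le_one_left (by positivity) ha
        _ ≤ _ := Real.add_one_le_exp _
    _ = Real.exp (∑ k ∈ Finset.range n, ‖q‖ ^ k) := (Real.exp_sum _ _).symm
    _ ≤ _ := Real.exp_le_exp.mpr (hs.sum_le_tsum _ fun _ _ => by positivity)

-- The sequence (c; q)_n has the nonzero limit (c; q)_∞, so its inverses converge and are bounded.
open Filter Topology in
theorem exists_norm_qPoch_inv_le {c q : ℂ} (hc : ‖c‖ < 1) (hq : ‖q‖ < 1) :
    ∃ C, ∀ n, ‖(qPoch c q n)⁻¹‖ ≤ C := by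
  have h : Tendsto (fun n => qPoch c q n) atTop (𝓝 (qPochInf c q)) :=
    (multipliable_qPochInf c hq).hasProd.tendsto_prod_nat
  obtain ⟨C, hC⟩ := (h.inv₀ (qPochInf_ne_zero hc hq)).norm.bddAbove_range
  exact ⟨C, fun n => hC ⟨n, rfl⟩⟩

theorem exists_norm_twoPhiOneCoeff_le {c q : ℂ} (hc : ‖c‖ < 1) (hq : ‖q‖ < 1) :
    ∃ C, 0 ≤ C ∧ ∀ a b : ℂ, ‖a‖ ≤ 1 → ‖b‖ ≤ 1 → ∀ n, ‖twoPhiOneCoeff a b c q n‖ ≤ C := by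
  obtain ⟨C₁, h₁⟩ := exists_norm_qPoch_inv_le hq hq
  obtain ⟨C₂, h₂⟩ := exists_norm_qPoch_inv_le hc hq
  have p₁ : 0 ≤ C₁ := (norm_nonneg _).trans (h₁ 0)
  have p₂ : 0 ≤ C₂ := (norm_nonneg _).trans (h₂ 0)
  set E := Real.exp (∑' k : ℕ, ‖q‖ ^ k)
  refine ⟨E * E * (C₁ * C₂), by positivity, fun a b ha hb n => ?_⟩
  rw [twoPhiOneCoeff, div_eq_mul_inv, mul_inv, norm_mul, norm_mul, norm_mul]
  gcongr
  exacts [norm_qPoch_le ha hq n, norm_qPoch_le hb hq n, h₁ n, h₂ n]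

theorem summable_norm_twoPhiOne {a b c q x : ℂ} (hc : ‖c‖ < 1) (hq : ‖q‖ < 1) (ha : ‖a‖ ≤ 1)
    (hb : ‖b‖ ≤ 1) (hx : ‖x‖ < 1) : Summable fun n => ‖twoPhiOneCoeff a b c q n * x ^ n‖ := by
  obtain ⟨C, -, hC⟩ := exists_norm_twoPhiOneCoeff_le hc hq
  refine ((summable_geometric_of_lt_one (norm_nonneg x) hx).mul_left C).of_nonneg_of_le
    (fun _ => norm_nonneg _) fun n => ?_
  rw [norm_mul, norm_pow]
  gcongr
  exact hC a b ha hb n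

theorem basicHypTerm_two_one (a b c q x : ℂ) :
    basicHypTerm [a, b] [c] q x = fun n => twoPhiOneCoeff a b c q n * x ^ n := by
  ext n
  simp [basicHypTerm, qPochs, twoPhiOneCoeff]

/-- There are n + 1 terms, each bounded uniformly on the circle. Linear growth against |t|ⁿ is
summable and supplies the dominating series. -/
theorem exists_norm_iwPoly_le {q : ℂ} (hq : ‖q‖ < 1) {t₁ t₂ t₃ t₄ : ℂ}
    (h₁ : ‖t₁‖ < 1) (h₂ : ‖t₂‖ < 1) (h₃ : ‖t₃‖ < 1) (h₄ : ‖t₄‖ < 1) :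
    ∃ K, ∀ z : ℂ, ‖z‖ = 1 → ∀ n : ℕ, ‖iwPoly t₁ t₂ t₃ t₄ q z n‖ ≤ (n + 1) * K := by
  obtain ⟨C, hC0, hC⟩ := exists_norm_twoPhiOneCoeff_le (norm_mul_lt_one h₁ h₂) hq
  obtain ⟨D, hD0, hD⟩ := exists_norm_twoPhiOneCoeff_le (norm_mul_lt_one h₃ h₄) hq
  refine ⟨C * D, fun z hz n => ?_⟩
  have hzi := norm_inv_circle hz
  refine (norm_sum_le_of_le (f := fun p : ℕ × ℕ => twoPhiOneCoeff (t₁ * z) (t₂ * z) (t₁ * t₂) q p.1 *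
    z⁻¹ ^ p.1 * (twoPhiOneCoeff (t₃ * z⁻¹) (t₄ * z⁻¹) (t₃ * t₄) q p.2 * z ^ p.2)) _
    (n := fun _ => C * D) fun p _ => ?_).trans ?_
  · rw [norm_mul, norm_mul, norm_mul, norm_pow, norm_pow, hz, hzi, one_pow, one_pow, mul_one,
      mul_one]
    gcongr
    · exact hC _ _ (norm_mul_circle_lt h₁ hz).le (norm_mul_circle_lt h₂ hz).le _
    · exact hD _ _ (norm_mul_circle_lt h₃ hzi).le (norm_mul_circle_lt h₄ hzi).le _
  · simp

/-- The generating function of Ismail and Wilson. -/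
theorem ismailWilsonProduct_eq_tsum {q : ℂ} (hq : ‖q‖ < 1) {t₁ t₂ t₃ t₄ t : ℂ}
    (h₁ : ‖t₁‖ < 1) (h₂ : ‖t₂‖ < 1) (h₃ : ‖t₃‖ < 1) (h₄ : ‖t₄‖ < 1) (ht : ‖t‖ < 1) (θ : ℝ) :
    ismailWilsonProduct t₁ t₂ t₃ t₄ q t θ =
      ∑' n, iwPoly t₁ t₂ t₃ t₄ q (expI θ) n * t ^ n := by
  have hz := norm_expI θ
  have hzi := norm_inv_circle hz
  rw [ismailWilsonProduct, basicHyp, basicHyp, basicHypTerm_two_one, basicHypTerm_two_one,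
    expNegI_eq_inv, tsum_mul_tsum_eq_tsum_sum_antidiagonal_of_summable_norm
      (summable_norm_twoPhiOne (norm_mul_lt_one h₁ h₂) hq (norm_mul_circle_lt h₁ hz).le
        (norm_mul_circle_lt h₂ hz).le (norm_mul_circle_lt ht hzi))
      (summable_norm_twoPhiOne (norm_mul_lt_one h₃ h₄) hq (norm_mul_circle_lt h₃ hzi).le
        (norm_mul_circle_lt h₄ hzi).le (norm_mul_circle_lt ht hz))]
  refine tsum_congr fun n => ?_
  rw [iwPoly, Finset.sum_mul]
  refine Finset.sum_congr rfl fun p hp => ?_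
  have hp' : p.1 + p.2 = n := by simpa using hp
  rw [← hp', pow_add]
  ring

theorem summable_succ_mul_geometric {r : ℝ} (h0 : 0 ≤ r) (h1 : r < 1) (K : ℝ) :
    Summable fun n : ℕ => (n + 1) * K * r ^ n := by
  have h : ‖r‖ < 1 := by rwa [Real.norm_of_nonneg h0]
  have := ((summable_pow_mul_geometric_of_norm_lt_one 1 h).add
    (summable_geometric_of_lt_one h0 h1)).mul_left K
  refine this.congr fun n => ?_
  rw [pow_one]; ring

theorem norm_iwPoly_mul_pow_le {K : ℝ} {t₁ t₂ t₃ t₄ q z t : ℂ} {n : ℕ}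
    (h : ‖iwPoly t₁ t₂ t₃ t₄ q z n‖ ≤ (n + 1) * K) :
    ‖iwPoly t₁ t₂ t₃ t₄ q z n * t ^ n‖ ≤ (n + 1) * K * ‖t‖ ^ n := by
  rw [norm_mul, norm_pow]
  gcongr

theorem continuous_iwPoly_expI {q : ℂ} (hq : ‖q‖ < 1) {t₁ t₂ t₃ t₄ : ℂ}
    (h₁ : ‖t₁‖ < 1) (h₂ : ‖t₂‖ < 1) (h₃ : ‖t₃‖ < 1) (h₄ : ‖t₄‖ < 1) (n : ℕ) :
    Continuous fun θ : ℝ => iwPoly t₁ t₂ t₃ t₄ q (expI θ) n :=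
  continuous_iwPoly hq continuous_const continuous_const continuous_const continuous_const
    continuous_expI (fun _ => h₁) (fun _ => h₂) (fun _ => h₃) (fun _ => h₄) norm_expI n

theorem continuous_ismailWilsonProduct {q : ℂ} (hq : ‖q‖ < 1) {t₁ t₂ t₃ t₄ t : ℂ}
    (h₁ : ‖t₁‖ < 1) (h₂ : ‖t₂‖ < 1) (h₃ : ‖t₃‖ < 1) (h₄ : ‖t₄‖ < 1) (ht : ‖t‖ < 1) :
    Continuous (ismailWilsonProduct t₁ t₂ t₃ t₄ q t) := by
  rw [funext (ismailWilsonProduct_eq_tsum hq h₁ h₂ h₃ h₄ ht)]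
  obtain ⟨K, hK⟩ := exists_norm_iwPoly_le hq h₁ h₂ h₃ h₄
  exact continuous_tsum
    (fun n => (continuous_iwPoly_expI hq h₁ h₂ h₃ h₄ n).mul continuous_const)
    (summable_succ_mul_geometric (norm_nonneg t) ht K)
    fun n θ => norm_iwPoly_mul_pow_le (hK _ (norm_expI θ) n)

open Filter Topology in
theorem hasSum_integral_ismailWilsonProduct {q : ℂ} (hq0 : q ≠ 0) (hq : ‖q‖ < 1)
    {t₁ t₂ t₃ t₄ t₅ t₆ : ℂ} (h₁ : ‖t₁‖ < 1) (h₂ : ‖t₂‖ < 1) (h₃ : ‖t₃‖ < 1) (h₄ : ‖t₄‖ < 1)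
    (h₅ : ‖t₅‖ < 1) (h₆ : ‖t₆‖ < 1) :
    HasSum (fun n => askeyWilsonMass t₁ t₂ t₃ t₄ q * (awNorm t₁ t₂ t₃ t₄ q n * (t₅ * t₆) ^ n))
      (∫ θ in (0 : ℝ)..Real.pi, ismailWilsonProduct t₁ t₂ t₃ t₄ q t₅ θ *
        ismailWilsonProduct t₁ t₂ t₃ t₄ q t₆ θ * awWeight t₁ t₂ t₃ t₄ q (expI θ)) := by
  obtain ⟨K, hK⟩ := exists_norm_iwPoly_le hq h₁ h₂ h₃ h₄
  have hw := continuous_awWeight_expI hq h₁ h₂ h₃ h₄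
  have s₅ := summable_succ_mul_geometric (norm_nonneg t₅) h₅ K
  have s₆ := summable_succ_mul_geometric (norm_nonneg t₆) h₆ K
  have hK0 : 0 ≤ K := by simpa using (norm_nonneg _).trans (hK 1 norm_one 0)
  have hs : ∀ t : ℂ, ‖t‖ < 1 → ∀ θ : ℝ,
      Summable fun n => ‖iwPoly t₁ t₂ t₃ t₄ q (expI θ) n * t ^ n‖ := fun t ht θ =>
    (summable_succ_mul_geometric (norm_nonneg t) ht K).of_nonneg_of_le (fun _ => norm_nonneg _)
      fun n => norm_iwPoly_mul_pow_le (hK _ (norm_expI θ) n)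
  have su : Summable fun p : ℕ × ℕ => (p.1 + 1) * K * ‖t₅‖ ^ p.1 * ((p.2 + 1) * K * ‖t₆‖ ^ p.2) :=
    s₅.mul_of_nonneg s₆ (fun n => by positivity) fun n => by positivity
  have key := intervalIntegral.hasSum_integral_of_dominated_convergence
    (μ := MeasureTheory.volume) (a := 0) (b := Real.pi)
    (F := fun (p : ℕ × ℕ) (θ : ℝ) => iwPoly t₁ t₂ t₃ t₄ q (expI θ) p.1 * t₅ ^ p.1 *
      (iwPoly t₁ t₂ t₃ t₄ q (expI θ) p.2 * t₆ ^ p.2) * awWeight t₁ t₂ t₃ t₄ q (expI θ))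
    (f := fun θ => ismailWilsonProduct t₁ t₂ t₃ t₄ q t₅ θ *
        ismailWilsonProduct t₁ t₂ t₃ t₄ q t₆ θ * awWeight t₁ t₂ t₃ t₄ q (expI θ))
    (fun p θ => (p.1 + 1) * K * ‖t₅‖ ^ p.1 * ((p.2 + 1) * K * ‖t₆‖ ^ p.2) *
      ‖awWeight t₁ t₂ t₃ t₄ q (expI θ)‖)
    (fun p => by
      have c := continuous_iwPoly_expI hq h₁ h₂ h₃ h₄
      exact ((((c p.1).mul continuous_const).mul
        ((c p.2).mul continuous_const)).mul hw).aestronglyMeasurable)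
    (fun p => Eventually.of_forall fun θ _ => by
      rw [norm_mul, norm_mul]
      gcongr
      · exact norm_iwPoly_mul_pow_le (hK _ (norm_expI θ) _)
      · exact norm_iwPoly_mul_pow_le (hK _ (norm_expI θ) _))
    (Eventually.of_forall fun θ _ => su.mul_right _)
    (by
      simp only [tsum_mul_right]
      exact (continuous_const.mul hw.norm).intervalIntegrable _ _)
    (Eventually.of_forall fun θ _ => by
      rw [ismailWilsonProduct_eq_tsum hq h₁ h₂ h₃ h₄ h₅, ismailWilsonProduct_eq_tsum hq h₁ h₂ h₃ h₄ h₆,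
        tsum_mul_tsum_of_summable_norm (hs t₅ h₅ θ) (hs t₆ h₆ θ)]
      exact (summable_mul_of_summable_norm (hs t₅ h₅ θ) (hs t₆ h₆ θ)).hasSum.mul_right _)
  have hterm : ∀ p : ℕ × ℕ, ∫ θ in (0 : ℝ)..Real.pi, iwPoly t₁ t₂ t₃ t₄ q (expI θ) p.1 * t₅ ^ p.1 *
      (iwPoly t₁ t₂ t₃ t₄ q (expI θ) p.2 * t₆ ^ p.2) * awWeight t₁ t₂ t₃ t₄ q (expI θ) =
      t₅ ^ p.1 * t₆ ^ p.2 *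
        if p.1 = p.2 then askeyWilsonMass t₁ t₂ t₃ t₄ q * awNorm t₁ t₂ t₃ t₄ q p.1 else 0 := fun p => by
    rw [← iwInner_eq hq0 hq h₁ h₂ h₃ h₄, iwInner, ← intervalIntegral.integral_const_mul]
    refine intervalIntegral.integral_congr fun θ _ => ?_
    ring
  simp only [hterm] at key
  -- Orthogonality kills the off-diagonal terms of the double series, so it is summed along the
  -- diagonal.
  have hinj : Function.Injective fun n : ℕ => (n, n) := fun a b h => congrArg Prod.fst h
  rw [← hinj.hasSum_iff] at key
  · refine Eq.subst (motive := fun f => HasSum f _) (funext fun n => ?_) key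
    simp only [Function.comp_apply, if_true, mul_pow]
    ring
  · rintro ⟨a, b⟩ hab
    have : a ≠ b := by rintro rfl; exact hab ⟨a, rfl⟩
    simp [this]

/-! ### Identification with the ₆φ₅ and conclusion. -/

theorem csqrt_sq (z : ℂ) : csqrt z ^ 2 = z := by
  rw [csqrt, one_div]
  exact_mod_cast Complex.cpow_nat_inv_pow z two_ne_zero

theorem qPoch_mul_neg (a q : ℂ) (n : ℕ) :
    qPoch a q n * qPoch (-a) q n = qPoch (a ^ 2) (q ^ 2) n := by
  simp only [qPoch, ← Finset.prod_mul_distrib]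
  exact Finset.prod_congr rfl fun k _ => by ring

theorem qPoch_succ' (a q : ℂ) (n : ℕ) : qPoch a q (n + 1) = (1 - a) * qPoch (a * q) q n := by
  rw [add_comm, qPoch_add, qPoch_succ, qPoch_zero]; simp

/-- The factorials of ±√a combine into (a; q²)_n, so only squares of the roots matter. With y =
t₁t₂t₃t₄/q the very-well-poised part collapses to (1 - y)/(1 - yq^{2n}), which turns 1/(y; q)_n into
(yqⁿ; q)_n/(yq; q)_{2n}. -/
theorem basicHypTerm_sixPhiFive {q : ℂ} (hq0 : q ≠ 0) (hq : ‖q‖ < 1) {t₁ t₂ t₃ t₄ : ℂ}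
    (h₁ : ‖t₁‖ < 1) (h₂ : ‖t₂‖ < 1) (h₃ : ‖t₃‖ < 1) (h₄ : ‖t₄‖ < 1)
    (hA : t₁ * t₂ * t₃ * t₄ ≠ q) (x : ℂ) (n : ℕ) :
    basicHypTerm (sixPhiFiveNum t₁ t₂ t₃ t₄ q) (sixPhiFiveDen t₁ t₂ t₃ t₄ q) q x n =
      awNorm t₁ t₂ t₃ t₄ q n * x ^ n := by
  have hA1 := norm_mul_four_lt_one h₁ h₂ h₃ h₄
  have e0 : basicHypTerm (sixPhiFiveNum t₁ t₂ t₃ t₄ q) (sixPhiFiveDen t₁ t₂ t₃ t₄ q) q x n =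
      qPoch (t₁ * t₂ * t₃ * t₄ / q) (q ^ 2) n *
        (qPoch (t₁ * t₃) q n * qPoch (t₁ * t₄) q n * qPoch (t₂ * t₃) q n * qPoch (t₂ * t₄) q n) /
      (qPoch (t₁ * t₂ * t₃ * t₄ * q) (q ^ 2) n * (qPoch q q n * qPoch (t₁ * t₂) q n *
        qPoch (t₃ * t₄) q n * qPoch (t₁ * t₂ * t₃ * t₄ / q) q n)) * x ^ n := by
    conv_rhs => rw [← csqrt_sq (t₁ * t₂ * t₃ * t₄ / q), ← csqrt_sq (t₁ * t₂ * t₃ * t₄ * q),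
      ← qPoch_mul_neg, ← qPoch_mul_neg, csqrt_sq]
    simp only [basicHypTerm, sixPhiFiveNum, sixPhiFiveDen, qPochs, List.map_cons, List.map_nil,
      List.prod_cons, List.prod_nil, List.length_cons, List.length_nil]
    rw [show (((0 + 1 + 1 + 1 + 1 + 1 : ℕ) : ℤ) + 1 - ((0 + 1 + 1 + 1 + 1 + 1 + 1 : ℕ) : ℤ)) = 0 by
      norm_num, zpow_zero]
    ring
  obtain ⟨y, hy⟩ : ∃ y, y = t₁ * t₂ * t₃ * t₄ / q := ⟨_, rfl⟩
  have hyA : t₁ * t₂ * t₃ * t₄ = y * q := by rw [hy]; field_simp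
  rw [hyA] at hA1 hA
  have hq2 := norm_sq_lt_one hq
  -- Here t₁t₂t₃t₄ ≠ q enters: 1 - y is the one factor of (y; q)_n not controlled by |yq| < 1.
  have b1 : 1 - y ≠ 0 := fun h => hA (by rw [← sub_eq_zero.mp h, one_mul])
  have b2 : qPoch y q n ≠ 0 := by
    rcases n with _ | n
    · simp [qPoch_zero]
    · rw [qPoch_succ']; exact mul_ne_zero b1 (qPoch_ne_zero hA1 hq n)
  have b3 : qPoch (y * q ^ 2) (q ^ 2) n ≠ 0 := by
    rw [pow_two, ← mul_assoc, ← pow_two]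
    exact qPoch_ne_zero (norm_mul_lt_one hA1 hq) hq2 n
  have b4 : qPoch (y * q) q (2 * n) ≠ 0 := qPoch_ne_zero hA1 hq _
  have c1 : qPoch y (q ^ 2) n * (1 - y * q ^ (2 * n)) = (1 - y) * qPoch (y * q ^ 2) (q ^ 2) n := by
    rw [← qPoch_succ', qPoch_succ, pow_mul]
  have c2 : qPoch y q n * qPoch (y * q ^ n) q n * (1 - y * q ^ (2 * n)) =
      (1 - y) * qPoch (y * q) q (2 * n) := by
    rw [← qPoch_add, ← two_mul, ← qPoch_succ, qPoch_succ']
  have b5 : 1 - y * q ^ (2 * n) ≠ 0 := fun h => by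
    rw [h, mul_zero] at c2
    exact mul_ne_zero b1 b4 c2.symm
  have ratio : qPoch y (q ^ 2) n / (qPoch (y * q ^ 2) (q ^ 2) n * qPoch y q n) =
      qPoch (y * q ^ n) q n / qPoch (y * q) q (2 * n) := by
    rw [div_eq_div_iff (mul_ne_zero b3 b2) b4]
    refine mul_right_cancel₀ (mul_ne_zero b5 b1) ?_
    linear_combination (1 - y) * qPoch (y * q) q (2 * n) * c1 -
      (1 - y) * qPoch (y * q ^ 2) (q ^ 2) n * c2
  rw [e0, awNorm, ← hy, hyA, show y * q * q ^ n * q⁻¹ = y * q ^ n by field_simp,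
    show y * q * q = y * q ^ 2 by ring]
  have alg : ∀ a b c d e f B C : ℂ, a / (b * c) = d / e →
      a * B / (b * (f * C * c)) = B * d / (e * (f * C)) := by
    intro a b c d e f B C h
    calc a * B / (b * (f * C * c)) = a / (b * c) * (B / (f * C)) := by rw [div_mul_div_comm]; ring
      _ = B * d / (e * (f * C)) := by rw [h, div_mul_div_comm]; ring
  have := alg _ _ _ _ _ (qPoch q q n * qPoch (t₁ * t₂) q n) (qPoch (t₁ * t₃) q n *
    qPoch (t₁ * t₄) q n * qPoch (t₂ * t₃) q n * qPoch (t₂ * t₄) q n) (qPoch (t₃ * t₄) q n) ratio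
  rw [this]
  ring

theorem askeyWilsonMass_ne_zero {q : ℂ} (hq : ‖q‖ < 1) {t₁ t₂ t₃ t₄ : ℂ}
    (h₁ : ‖t₁‖ < 1) (h₂ : ‖t₂‖ < 1) (h₃ : ‖t₃‖ < 1) (h₄ : ‖t₄‖ < 1) :
    askeyWilsonMass t₁ t₂ t₃ t₄ q ≠ 0 := by
  rw [askeyWilsonMass_eq]
  refine div_ne_zero (mul_ne_zero ?_ (qPochInf_ne_zero (norm_mul_four_lt_one h₁ h₂ h₃ h₄) hq))
    (mul_ne_zero (qPochInf_ne_zero hq hq) (awPairs_ne_zero hq h₁ h₂ h₃ h₄))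
  exact mul_ne_zero two_ne_zero (by exact_mod_cast Real.pi_ne_zero)

theorem mainTheorem10 (q : ℝ) (hq_gt : -1 < q) (hq_lt : q < 1) (hq_ne : q ≠ 0)
    (t₁ t₂ t₃ t₄ t₅ t₆ : ℂ)
    (h₁ : ‖t₁‖ < 1) (h₂ : ‖t₂‖ < 1) (h₃ : ‖t₃‖ < 1)
    (h₄ : ‖t₄‖ < 1) (h₅ : ‖t₅‖ < 1) (h₆ : ‖t₆‖ < 1)
    (hA : t₁ * t₂ * t₃ * t₄ ≠ (q : ℂ)) :
    (∀ θ : ℝ, ∀ t ∈ ({t₅, t₆} : Set ℂ),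
      Summable (basicHypTerm [t₁ * expI θ, t₂ * expI θ] [t₁ * t₂] q (t * expNegI θ)) ∧
      Summable (basicHypTerm [t₃ * expNegI θ, t₄ * expNegI θ] [t₃ * t₄] q (t * expI θ))) ∧
    Summable (basicHypTerm (sixPhiFiveNum t₁ t₂ t₃ t₄ q) (sixPhiFiveDen t₁ t₂ t₃ t₄ q) q
      (t₅ * t₆)) ∧
    IntervalIntegrable
      (fun θ : ℝ => ismailWilsonProduct t₁ t₂ t₃ t₄ q t₅ θ * ismailWilsonProduct t₁ t₂ t₃ t₄ q t₆ θ *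
        askeyWilsonWeight t₁ t₂ t₃ t₄ q θ) MeasureTheory.volume 0 Real.pi ∧
    ∫ θ in (0 : ℝ)..Real.pi,
        ismailWilsonProduct t₁ t₂ t₃ t₄ q t₅ θ * ismailWilsonProduct t₁ t₂ t₃ t₄ q t₆ θ *
          askeyWilsonWeight t₁ t₂ t₃ t₄ q θ =
      askeyWilsonMass t₁ t₂ t₃ t₄ q *
        basicHyp (sixPhiFiveNum t₁ t₂ t₃ t₄ q) (sixPhiFiveDen t₁ t₂ t₃ t₄ q) q (t₅ * t₆) := by
  have hq : ‖(q : ℂ)‖ < 1 := by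
    rw [Complex.norm_real, Real.norm_eq_abs]; exact abs_lt.mpr ⟨hq_gt, hq_lt⟩
  have hq0 : (q : ℂ) ≠ 0 := by exact_mod_cast hq_ne
  have key := hasSum_integral_ismailWilsonProduct hq0 hq h₁ h₂ h₃ h₄ h₅ h₆
  simp only [← basicHypTerm_sixPhiFive hq0 hq h₁ h₂ h₃ h₄ hA] at key
  simp only [askeyWilsonWeight_eq]
  refine ⟨fun θ t ht => ?_, ?_, ?_, ?_⟩
  · have ht1 : ‖t‖ < 1 := by rcases ht with rfl | rfl <;> assumption
    have hz := norm_expI θ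
    have hzi := norm_inv_circle hz
    rw [basicHypTerm_two_one, basicHypTerm_two_one, expNegI_eq_inv]
    exact ⟨(summable_norm_twoPhiOne (norm_mul_lt_one h₁ h₂) hq (norm_mul_circle_lt h₁ hz).le
        (norm_mul_circle_lt h₂ hz).le (norm_mul_circle_lt ht1 hzi)).of_norm,
      (summable_norm_twoPhiOne (norm_mul_lt_one h₃ h₄) hq (norm_mul_circle_lt h₃ hzi).le
        (norm_mul_circle_lt h₄ hzi).le (norm_mul_circle_lt ht1 hz)).of_norm⟩
  -- Convergence of the ₆φ₅ is inherited from the termwise integration, the mass being nonzero.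
  · exact (summable_mul_left_iff (askeyWilsonMass_ne_zero hq h₁ h₂ h₃ h₄)).mp key.summable
  · exact (((continuous_ismailWilsonProduct hq h₁ h₂ h₃ h₄ h₅).mul
      (continuous_ismailWilsonProduct hq h₁ h₂ h₃ h₄ h₆)).mul
      (continuous_awWeight_expI hq h₁ h₂ h₃ h₄)).intervalIntegrable _ _
  · rw [← key.tsum_eq, tsum_mul_left, basicHyp]
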